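/- Let $p\ge 2$ and $m\ge 1$ be integers and let $\sigma_0>0$, $\theta_1,\theta_2>1$, $\kappa_A,\kappa_B\ge 0$, $\kappa_C\ge 1$, $L_p\ge 3$, $\kappa_{high}\ge 0$, $\kappa_p$ be real numbers. All vector norms are Euclidean, and $\|T\|=\max_{\|v_1\|=\dots=\|v_p\|=1}|T[v_1,\dots,v_p]|$ for a $p$-linear form $T$ on $\mathbb{R}^n$; $T[s]^i=T[s,\dots,s]$. **Assumptions on $f:\mathbb{R}^n\to\mathbb{R}$.** (1) $f$ is $p$ times continuously differentiable. (2) $f(x)\ge f_{\rm low}$ for all $x$. (3) $\|\nabla^p f(x)-\nabla^p f(y)\|\le L_p\|x-y\|$ for all $x,y$. (4) $\nabla^i f(x)[d]^i\ge-\kappa_{high}$ for all $x$, all $\|d\|\le 1$ and all $3\le i\le p-1$. (5) If $p\ge 3$, then $\|\nabla^p f(x)\|\le\kappa_p$ for all $x$. **Algorithm ARp-approx.** From $x_0\in\mathbb{R}^n$ and $\sigma_0$, the algorithm produces $p$-linear forms $T_k$, steps $s_k$, iterates $x_{k+1}=x_k+s_k$ and parameters $\sigma_{k+1}=\sigma_k+\sigma_k\|s_k\|^{p+1}$,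 $k\ge0$, as follows. With $\overline T_k(s)=f(x_k)+\sum_{i=1}^{p-1}\frac1{i!}\nabla^i f(x_k)[s]^i+\frac1{p!}T_k[s]^p$ and $m_k(s)=\overline T_k(s)+\frac{\sigma_k}{(p+1)!}\|s\|^{p+1}$, the step $s_k$ is any vector with $$m_k(s_k)\le m_k(0),\qquad \|\nabla\overline T_k(s_k)\|\le\frac{\theta_1\sigma_k\|s_k\|^p}{p!},\qquad \max[0,-\lambda_{\min}(\nabla^2\overline T_k(s_k))]\le\frac{\theta_2\sigma_k\|s_k\|^{p-1}}{(p-1)!}.$$ The tensors $T_k$ are arbitrary subject to the following condition, in which $\|s_j\|:=1$ for $j<0$ and $\widetilde T_k=\int_0^1\nabla^pf(x_k+ts_k)\,dt$: if $k\bmod m=0$, then $\|T_k-\nabla^pf(x_k)\|\le\min\bigl(\kappa_A\sum_{i=1}^m\|s_{k-i}\|,\ \kappa_B\bigr)$; otherwise $\|T_k-\widetilde T_{k-1}\|\le\kappa_C\|T_{k-1}-\widetilde T_{k-1}\|$. **Theorem.** For all real $\Delta_0,G_0,B_0$ there is a constant $C>0$, depending only on $p,m,\sigma_0,\theta_1,\theta_2,\kappa_A,\kappa_B,\kappa_C,L_p,\kappa_{high},\kappa_p,\Delta_0,G_0,B_0$,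 such that for every $n$, every $f$ satisfying (1)–(5) and every sequence of iterates $(x_k)$ produced by ARp-approx with $f(x_0)-f_{\rm low}\le\Delta_0$, $\|\nabla f(x_0)\|\le G_0$ and $\max[0,-\lambda_{\min}(\nabla^2 f(x_0))]\le B_0$, the following hold. 1. $\displaystyle\min_{1\le j\le k+1}\|\nabla f(x_j)\|\le C\,(k+1)^{-p/(p+1)}$ for all $k\ge0$. 2. $\displaystyle\min_{1\le j\le k+1}\max[0,-\lambda_{\min}(\nabla^2f(x_j))]\le C\,(k+1)^{-(p-1)/(p+1)}$ for all $k\ge0$. 3. For all $\varepsilon_1,\varepsilon_2>0$ there is an index $j\le C\max[\varepsilon_1^{-(p+1)/p},\varepsilon_2^{-(p+1)/(p-1)}]$ with $\|\nabla f(x_j)\|\le\varepsilon_1$ and $\lambda_{\min}(\nabla^2f(x_j))\ge-\varepsilon_2$. -/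

import Mathlib

open scoped Gradient

noncomputable section

namespace ARpApprox

variable {n : ℕ}

/-- `ℝⁿ` with the Euclidean norm. -/
abbrev Vec (n : ℕ) : Type := EuclideanSpace ℝ (Fin n)

/-- Tensors of order `p`: `p`-linear forms on `ℝⁿ`, with the norm
`‖T‖ = max_{‖s₁‖ = ⋯ = ‖s_p‖ = 1} |T[s₁, …, s_p]|` (not necessarily symmetric). -/
abbrev Tensor (n p : ℕ) : Type := ContinuousMultilinearMap ℝ (fun _ : Fin p => Vec n) ℝ

/-- The Hessian of `F` at `x`, as an operator on `ℝⁿ`. -/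
def hessian (F : Vec n → ℝ) (x : Vec n) : Vec n →L[ℝ] Vec n :=
  fderiv ℝ (∇ F) x

/-- The leftmost eigenvalue of an operator on `ℝⁿ`. (It is only applied to Hessians of `C²`
functions, which are self-adjoint and so have a smallest eigenvalue when `n ≥ 1`.) -/
def lambdaMin (A : Vec n →L[ℝ] Vec n) : ℝ :=
  sInf {μ : ℝ | Module.End.HasEigenvalue (A : Vec n →ₗ[ℝ] Vec n) μ}

/-- The negative curvature `max[0, -λ_min(∇²F(x))]`. -/
def negCurv (F : Vec n → ℝ) (x : Vec n) : ℝ :=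
  max 0 (-lambdaMin (hessian F x))

/-- `x` is an `(ε₁, ε₂)` second-order approximate stationary point of `f`. -/
def IsSecondOrderStationary (f : Vec n → ℝ) (ε₁ ε₂ : ℝ) (x : Vec n) : Prop :=
  ‖∇ f x‖ ≤ ε₁ ∧ -ε₂ ≤ lambdaMin (hessian f x)

/-- The assumptions on the objective function `f : ℝⁿ → ℝ`. -/
structure ObjectiveAssumptions (p : ℕ) (L κhigh κp flow : ℝ) (f : Vec n → ℝ) : Prop where
  contDiff : ContDiff ℝ p f
  lower_bound : ∀ x, flow ≤ f x
  lipschitz : ∀ x y, ‖iteratedFDeriv ℝ p f x - iteratedFDeriv ℝ p f y‖ ≤ L * ‖x - y‖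
  intermediate : ∀ i ∈ Finset.Icc 3 (p - 1), ∀ x d : Vec n, ‖d‖ ≤ 1 →
    -κhigh ≤ iteratedFDeriv ℝ i f x (fun _ => d)
  bounded : 3 ≤ p → ∀ x, ‖iteratedFDeriv ℝ p f x‖ ≤ κp

/-- The `p`th-order Taylor expansion of `f` at `x` as a function of the step `s`, with the exact
derivatives up to order `p - 1` and with `T` in place of the `p`th derivative. -/
def approxTaylor (p : ℕ) (f : Vec n → ℝ) (x : Vec n) (T : Tensor n p) (s : Vec n) : ℝ :=
  f x + ∑ i ∈ Finset.Icc 1 (p - 1), (1 / (i.factorial : ℝ)) * iteratedFDeriv ℝ i f x (fun _ => s)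
    + (1 / (p.factorial : ℝ)) * T (fun _ => s)

/-- The regularized model. -/
def model (p : ℕ) (f : Vec n → ℝ) (x : Vec n) (T : Tensor n p) (σ : ℝ) (s : Vec n) : ℝ :=
  approxTaylor p f x T s + σ / ((p + 1).factorial : ℝ) * ‖s‖ ^ (p + 1)

/-- The step length `‖s_j‖`, with the convention that it is `1` for negative `j`. -/
def stepLength (s : ℕ → Vec n) (j : ℤ) : ℝ :=
  if 0 ≤ j then ‖s j.toNat‖ else 1

/-- The average of the `p`th derivative over the segment from `x` to `x + s`. -/
def averagedTensor (p : ℕ) (f : Vec n → ℝ) (x s : Vec n) : Tensor n p :=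
  ∫ t in (0 : ℝ)..1, iteratedFDeriv ℝ p f (x + t • s)

/-- The condition on the tensor approximations `T_k` along the iterates `x_k` and steps `s_k`. -/
structure TensorCondition (p m : ℕ) (κA κB κC : ℝ) (f : Vec n → ℝ)
    (x s : ℕ → Vec n) (T : ℕ → Tensor n p) : Prop where
  restart : ∀ k : ℕ, k % m = 0 →
    ‖T k - iteratedFDeriv ℝ p f (x k)‖ ≤
      min (κA * ∑ i ∈ Finset.Icc 1 m, stepLength s ((k : ℤ) - (i : ℤ))) κB
  update : ∀ k : ℕ, (k + 1) % m ≠ 0 →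
    ‖T (k + 1) - averagedTensor p f (x k) (s k)‖ ≤
      κC * ‖T k - averagedTensor p f (x k) (s k)‖

/-- `x`, `s`, `σ`, `T` are the iterates, steps, regularization parameters and tensor approximations
of a run of the algorithm, started with the regularization parameter `σ₀`. The subroutine that
produces `T_k` is arbitrary, subject to `TensorCondition`. -/
structure IsRun (p m : ℕ) (σ₀ θ₁ θ₂ κA κB κC : ℝ) (f : Vec n → ℝ)
    (x s : ℕ → Vec n) (σ : ℕ → ℝ) (T : ℕ → Tensor n p) : Prop where
  tensor : TensorCondition p m κA κB κC f x s T
  model_decrease : ∀ k, model p f (x k) (T k) (σ k) (s k) - model p f (x k) (T k) (σ k) 0 ≤ 0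
  first_order : ∀ k, ‖∇ (approxTaylor p f (x k) (T k)) (s k)‖ ≤
    θ₁ * σ k * ‖s k‖ ^ p / (p.factorial : ℝ)
  second_order : ∀ k, negCurv (approxTaylor p f (x k) (T k)) (s k) ≤
    θ₂ * σ k * ‖s k‖ ^ (p - 1) / ((p - 1).factorial : ℝ)
  iterate : ∀ k, x (k + 1) = x k + s k
  sigma_zero : σ 0 = σ₀
  sigma_succ : ∀ k, σ (k + 1) = σ k + σ k * ‖s k‖ ^ (p + 1)

end ARpApprox

end

/-!
The derivatives of the model `approxTaylor p f x T` at `s` approximate those of `f` at `x + s` as in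
Taylor's theorem, although `T` need not be symmetric: the `p`th derivative of the model is the
symmetrization of `T`, and since the derivatives of `f` are symmetric, symmetrizing does not
increase the distance from `T` to `∇ᵖf(x)`.

The distance of the averaged tensor to the `p`th derivatives at both ends of a step is at most a
multiple of the step length. As `T_k` is restarted every `m` steps, its error is at most a
multiple of the sum `W_k` of the last `2 * m` step lengths. With `r_k = ‖s_k‖`, the gradient and
the negative curvature at `x_{k+1}` are therefore `O((1 + σ_k) (r_k + W_k)^p)` and
`O((1 + σ_k) (r_k + W_k)^(p-1))`, and `f` decreases by at least `σ_k r_k^(p+1) / (p+1)!` up to an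
error `O((r_k + W_k)^(p+1))`.

Summed over the run, the errors are at most a multiple of `1 + ∑ r_k^(p+1)`. Since
`σ_{k+1} - σ_k = σ_k r_k^(p+1)`, the increase of `σ` beyond a fixed level is paid for by the
decrease of `f`, which is bounded below. The one step on which `σ` may jump over that level is
bounded because `σ`, the gradient, the curvature and the tensor error are, and the model has no
decrease along long steps. Hence `σ` is bounded, so is `∑ (r_k + W_k)^(p+1)`, and among the first
`k + 1` steps one has `(r_j + W_j)^(p+1) = O(1 / (k + 1))`.
-/

noncomputable section

namespace ARpApprox

section Symmetry

variable {E F : Type*} [NormedAddCommGroup E] [NormedSpace ℝ E] [NormedAddCommGroup F]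
  [NormedSpace ℝ F] {f : E → F}

theorem contDiff_iteratedFDeriv_apply {k m : ℕ} (hf : ContDiff ℝ (k + m : ℕ) f)
    (v : Fin k → E) : ContDiff ℝ m fun y => iteratedFDeriv ℝ k f y v :=
  (ContinuousMultilinearMap.apply ℝ (fun _ : Fin k => E) F v).contDiff.comp
    (hf.iteratedFDeriv_right (by norm_cast; omega))

theorem iteratedFDeriv_add_two_apply {k : ℕ} (hf : ContDiff ℝ (k + 2 : ℕ) f) (x : E)
    (v : Fin (k + 2) → E) :
    iteratedFDeriv ℝ (k + 2) f x v =
      fderiv ℝ (fderiv ℝ fun y => iteratedFDeriv ℝ k f y (Fin.tail (Fin.tail v))) x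
        (v 0) (v 1) := by
  have hdiff (j : ℕ) (hj : j < k + 2) : Differentiable ℝ (iteratedFDeriv ℝ j f) :=
    hf.differentiable_iteratedFDeriv (by exact_mod_cast hj)
  have hslice : ContDiff ℝ 2 fun y => iteratedFDeriv ℝ k f y (Fin.tail (Fin.tail v)) :=
    contDiff_iteratedFDeriv_apply hf _
  have hslice' : DifferentiableAt ℝ
      (fderiv ℝ fun y => iteratedFDeriv ℝ k f y (Fin.tail (Fin.tail v))) x :=
    (hslice.fderiv_right (m := 1) (by norm_num)).differentiable (by norm_num) x
  rw [(hdiff (k + 1) (by omega) x).iteratedFDeriv_succ_apply_left']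
  simp only [(hdiff k (by omega) _).iteratedFDeriv_succ_apply_left']
  rw [fderiv_clm_apply hslice' (by fun_prop)]
  simp [Fin.tail]

theorem iteratedFDeriv_comp_swap_zero_one {k : ℕ} (hf : ContDiff ℝ (k + 2 : ℕ) f) (x : E)
    (v : Fin (k + 2) → E) :
    iteratedFDeriv ℝ (k + 2) f x (v ∘ Equiv.swap 0 1) = iteratedFDeriv ℝ (k + 2) f x v := by
  have htail : Fin.tail (Fin.tail (v ∘ Equiv.swap 0 1)) = Fin.tail (Fin.tail v) := by
    funext a
    exact congrArg v (Equiv.swap_apply_of_ne_of_ne (Fin.succ_ne_zero _)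
      (by simp [Fin.ext_iff]))
  have hslice : ContDiff ℝ 2 fun y => iteratedFDeriv ℝ k f y (Fin.tail (Fin.tail v)) :=
    contDiff_iteratedFDeriv_apply hf _
  have hsymm := hslice.contDiffAt.isSymmSndFDerivAt (x := x) (by simp)
  rw [iteratedFDeriv_add_two_apply hf, iteratedFDeriv_add_two_apply hf, htail]
  simpa using hsymm (v 1) (v 0)

theorem iteratedFDeriv_comp_swap_succ {k : ℕ} (hf : ContDiff ℝ (k + 1 : ℕ) f) (i : Fin k) (x : E)
    (v : Fin (k + 1) → E) :
    iteratedFDeriv ℝ (k + 1) f x (v ∘ Equiv.swap i.castSucc i.succ) =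
      iteratedFDeriv ℝ (k + 1) f x v := by
  induction k generalizing x with
  | zero => exact i.elim0
  | succ k ih =>
    rcases Fin.eq_zero_or_eq_succ i with rfl | ⟨j, rfl⟩
    · exact iteratedFDeriv_comp_swap_zero_one hf x v
    · have hdiff : DifferentiableAt ℝ (iteratedFDeriv ℝ (k + 1) f) x :=
        hf.differentiable_iteratedFDeriv (by norm_cast; omega) x
      have htail : Fin.tail (v ∘ Equiv.swap j.succ.castSucc j.succ.succ) =
          Fin.tail v ∘ Equiv.swap j.castSucc j.succ := by
        funext a
        exact congrArg v (Function.Embedding.swap_apply (Fin.succEmb _) j.castSucc j.succ a)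
      have hhead : (v ∘ Equiv.swap j.succ.castSucc j.succ.succ) 0 = v 0 :=
        congrArg v (Equiv.swap_apply_of_ne_of_ne (by simp [Fin.ext_iff]) (by simp [Fin.ext_iff]))
      rw [hdiff.iteratedFDeriv_succ_apply_left', hdiff.iteratedFDeriv_succ_apply_left', htail,
        hhead]
      simp only [ih (hf.of_le (by norm_cast; omega))]

theorem iteratedFDeriv_comp_perm_of_contDiff {k : ℕ} (hf : ContDiff ℝ k f) (x : E)
    (v : Fin k → E) (τ : Equiv.Perm (Fin k)) :
    iteratedFDeriv ℝ k f x (fun i => v (τ i)) = iteratedFDeriv ℝ k f x v := by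
  cases k with
  | zero => congr 1; exact Subsingleton.elim _ _
  | succ k =>
    have hτ : τ ∈ Submonoid.closure (Set.range fun i : Fin k => Equiv.swap i.castSucc i.succ) :=
      Equiv.Perm.mclosure_swap_castSucc_succ k ▸ Submonoid.mem_top τ
    induction hτ using Submonoid.closure_induction generalizing v with
    | mem τ h =>
      obtain ⟨i, rfl⟩ := h
      exact iteratedFDeriv_comp_swap_succ hf i x v
    | one => rfl
    | mul a b _ _ ha hb => exact (hb fun i => v (a i)).trans (ha v)

end Symmetry

section PowerSeries

variable {E F : Type*} [NormedAddCommGroup E] [NormedSpace ℝ E] [NormedAddCommGroup F]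
  [NormedSpace ℝ F]

theorem exists_hasFiniteFPowerSeriesOnBall_iteratedFDeriv {f : E → F}
    {q : FormalMultilinearSeries ℝ E F} {x : E} {d : ℕ} {r : ENNReal} (k : ℕ)
    (h : HasFiniteFPowerSeriesOnBall f q x (d + k) r) :
    ∃ q' : FormalMultilinearSeries ℝ E (E [×k]→L[ℝ] F),
      HasFiniteFPowerSeriesOnBall (iteratedFDeriv ℝ k f) q' x d r := by
  induction k generalizing d with
  | zero =>
    rw [iteratedFDeriv_zero_eq_comp]
    exact ⟨_, (continuousMultilinearCurryFin0 ℝ E F).symm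
      |>.toContinuousLinearEquiv.toContinuousLinearMap.comp_hasFiniteFPowerSeriesOnBall h⟩
  | succ k ih =>
    obtain ⟨q', hq'⟩ := ih (d := d + 1) (by rwa [add_assoc, add_comm 1 k])
    rw [iteratedFDeriv_succ_eq_comp_left]
    exact ⟨_, (continuousMultilinearCurryLeftEquiv ℝ (fun _ : Fin (k + 1) => E) F).symm
      |>.toContinuousLinearEquiv.toContinuousLinearMap.comp_hasFiniteFPowerSeriesOnBall hq'.fderiv⟩

theorem iteratedFDeriv_eq_const_of_hasFiniteFPowerSeriesOnBall {f : E → F}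
    {q : FormalMultilinearSeries ℝ E F} {x : E} {d : ℕ}
    (h : HasFiniteFPowerSeriesOnBall f q x (d + 1) ⊤) (y : E) :
    iteratedFDeriv ℝ d f y = iteratedFDeriv ℝ d f x := by
  obtain ⟨q', hq'⟩ := exists_hasFiniteFPowerSeriesOnBall_iteratedFDeriv (d := 1) d
    (by rwa [add_comm])
  exact hq'.eq_const_of_bound_one y (by simp)

theorem norm_sum_comp_perm_le {k : ℕ} (B : E [×k]→L[ℝ] F) (v : Fin k → E) :
    ‖∑ τ : Equiv.Perm (Fin k), B fun i => v (τ i)‖ ≤ k.factorial * (‖B‖ * ∏ i, ‖v i‖) := by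
  refine (norm_sum_le_of_le _ fun τ _ => (B.le_opNorm _).trans_eq
    (congrArg (‖B‖ * ·) (Equiv.prod_comp τ fun i => ‖v i‖))).trans_eq ?_
  simp [Fintype.card_perm]

/- The `k`th derivative of a power series is the symmetrization of `k! • q k`, and symmetrization
does not increase the norm and fixes `A`. -/
theorem norm_iteratedFDeriv_sub_le_of_hasFPowerSeriesOnBall [CompleteSpace F] {P : E → F}
    {q : FormalMultilinearSeries ℝ E F} {y : E} {r : ENNReal} (h : HasFPowerSeriesOnBall P q y r)
    {k : ℕ} {A : E [×k]→L[ℝ] F}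
    (hA : ∀ (v : Fin k → E) (τ : Equiv.Perm (Fin k)), A (fun i => v (τ i)) = A v) :
    ‖iteratedFDeriv ℝ k P y - A‖ ≤ ‖k.factorial • q k - A‖ := by
  refine ContinuousMultilinearMap.opNorm_le_bound (norm_nonneg _) fun v => ?_
  have hsymmetrize : (k.factorial : ℝ) • (iteratedFDeriv ℝ k P y - A) v =
      ∑ τ : Equiv.Perm (Fin k), (k.factorial • q k - A) fun i => v (τ i) := by
    simp [hA, h.iteratedFDeriv_eq_sum_of_completeSpace v, Finset.sum_sub_distrib,
      Finset.smul_sum, Fintype.card_perm, smul_sub, Nat.cast_smul_eq_nsmul]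
  have hnorm := norm_sum_comp_perm_le (k.factorial • q k - A) v
  rw [← hsymmetrize, norm_smul, Real.norm_natCast] at hnorm
  exact le_of_mul_le_mul_left hnorm (by positivity)

end PowerSeries

section Taylor

variable {E F : Type*} [NormedAddCommGroup E] [NormedSpace ℝ E] [NormedAddCommGroup F]
  [NormedSpace ℝ F]

theorem norm_iteratedFDeriv_le_of_iteratedFDeriv_zero {h : E → F} {p : ℕ} (hh : ContDiff ℝ p h)
    (h0 : ∀ i < p, iteratedFDeriv ℝ i h 0 = 0) {r M : ℝ}
    (hM : ∀ s, ‖s‖ ≤ r → ‖iteratedFDeriv ℝ p h s‖ ≤ M) {i : ℕ} (hi : i ≤ p) {s : E}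
    (hs : ‖s‖ ≤ r) : ‖iteratedFDeriv ℝ i h s‖ ≤ M * r ^ (p - i) := by
  induction hi using Nat.decreasingInduction generalizing s with
  | self => simpa using hM s hs
  | of_succ i hi ih =>
    have hr : 0 ≤ r := (norm_nonneg _).trans hs
    have hM0 : 0 ≤ M := (norm_nonneg _).trans (hM s hs)
    have hdiff : Differentiable ℝ (iteratedFDeriv ℝ i h) :=
      hh.differentiable_iteratedFDeriv (by exact_mod_cast hi)
    have hmean := (convex_closedBall (0 : E) r).norm_image_sub_le_of_norm_fderiv_le
      (f := iteratedFDeriv ℝ i h) (C := M * r ^ (p - (i + 1))) (fun y _ => hdiff y)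
      (fun y hy => by
        rw [norm_fderiv_iteratedFDeriv]
        exact ih (by simpa using hy))
      (Metric.mem_closedBall_self hr) (by simpa using hs)
    rw [h0 i hi, sub_zero, sub_zero] at hmean
    calc ‖iteratedFDeriv ℝ i h s‖ ≤ M * r ^ (p - (i + 1)) * ‖s‖ := hmean
      _ ≤ M * r ^ (p - (i + 1)) * r := by gcongr
      _ = M * r ^ (p - i) := by rw [mul_assoc, ← pow_succ]; congr 2; omega

theorem iteratedFDeriv_comp_add_left_sub {f P : E → F} {p i : ℕ} (hf : ContDiff ℝ p f)
    (hP : ContDiff ℝ p P) (hi : i ≤ p) (x y : E) :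
    iteratedFDeriv ℝ i (fun z => f (x + z) - P z) y =
      iteratedFDeriv ℝ i f (x + y) - iteratedFDeriv ℝ i P y := by
  have hi' : (i : WithTop ℕ∞) ≤ p := by exact_mod_cast hi
  have hshift : ContDiff ℝ i fun z => f (x + z) := (hf.of_le hi').comp (by fun_prop)
  rw [← iteratedFDeriv_comp_add_left]
  exact iteratedFDeriv_sub_apply hshift.contDiffAt (hP.of_le hi').contDiffAt

theorem norm_iteratedFDeriv_sub_le_of_lipschitz [CompleteSpace F] {f P : E → F} {p : ℕ}
    (hf : ContDiff ℝ p f) {L : ℝ} (hL : 0 ≤ L)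
    (hlip : ∀ x y, ‖iteratedFDeriv ℝ p f x - iteratedFDeriv ℝ p f y‖ ≤ L * ‖x - y‖) {x : E}
    {q : FormalMultilinearSeries ℝ E F} (hP : HasFiniteFPowerSeriesOnBall P q 0 (p + 1) ⊤)
    (hq : ∀ i < p, i.factorial • q i = iteratedFDeriv ℝ i f x) (s : E) {i : ℕ} (hi : i ≤ p) :
    ‖iteratedFDeriv ℝ i f (x + s) - iteratedFDeriv ℝ i P s‖ ≤
      (L * ‖s‖ + ‖p.factorial • q p - iteratedFDeriv ℝ p f x‖) * ‖s‖ ^ (p - i) := by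
  have hPsmooth : ContDiff ℝ p P := by
    simpa [contDiffOn_univ] using hP.cpolynomialOn.contDiffOn (n := p)
  have hzero (j : ℕ) (hj : j ≤ p) : ‖iteratedFDeriv ℝ j P 0 - iteratedFDeriv ℝ j f x‖ ≤
      ‖j.factorial • q j - iteratedFDeriv ℝ j f x‖ :=
    norm_iteratedFDeriv_sub_le_of_hasFPowerSeriesOnBall hP.toHasFPowerSeriesOnBall
      (iteratedFDeriv_comp_perm_of_contDiff (hf.of_le (by exact_mod_cast hj)) x)
  have hsub : ContDiff ℝ p fun z => f (x + z) - P z := (hf.comp (by fun_prop)).sub hPsmooth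
  rw [← iteratedFDeriv_comp_add_left_sub hf hPsmooth hi]
  refine norm_iteratedFDeriv_le_of_iteratedFDeriv_zero hsub (fun j hj => ?_) (fun y hy => ?_) hi
    le_rfl
  · rw [iteratedFDeriv_comp_add_left_sub hf hPsmooth hj.le, add_zero, ← norm_eq_zero, norm_sub_rev]
    exact le_antisymm ((hzero j hj.le).trans_eq (by rw [hq j hj, sub_self, norm_zero]))
      (norm_nonneg _)
  · rw [iteratedFDeriv_comp_add_left_sub hf hPsmooth le_rfl,
      iteratedFDeriv_eq_const_of_hasFiniteFPowerSeriesOnBall hP y]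
    have hlip' : ‖iteratedFDeriv ℝ p f (x + y) - iteratedFDeriv ℝ p f x‖ ≤ L * ‖y‖ := by
      simpa using hlip (x + y) x
    calc _ ≤ ‖iteratedFDeriv ℝ p f (x + y) - iteratedFDeriv ℝ p f x‖ +
          ‖iteratedFDeriv ℝ p f x - iteratedFDeriv ℝ p P 0‖ :=
        norm_sub_le_norm_sub_add_norm_sub _ _ _
      _ ≤ L * ‖s‖ + ‖p.factorial • q p - iteratedFDeriv ℝ p f x‖ := by
        rw [norm_sub_rev (iteratedFDeriv ℝ p f x)]
        exact add_le_add (hlip'.trans (by gcongr)) (hzero p le_rfl)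

end Taylor

section ApproxTaylor

variable {n p : ℕ}

/-- The coefficients of `approxTaylor p f x T`, a polynomial in the step, as a formal multilinear
series. -/
def approxTaylorSeries (p : ℕ) (f : Vec n → ℝ) (x : Vec n) (T : Tensor n p) :
    FormalMultilinearSeries ℝ (Vec n) ℝ := fun i =>
  if i < p then (1 / (i.factorial : ℝ)) • iteratedFDeriv ℝ i f x
  else if h : p = i then h ▸ ((1 / (p.factorial : ℝ)) • T) else 0

theorem approxTaylorSeries_of_lt (f : Vec n → ℝ) (x : Vec n) (T : Tensor n p) {i : ℕ}
    (hi : i < p) :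
    approxTaylorSeries p f x T i = (1 / (i.factorial : ℝ)) • iteratedFDeriv ℝ i f x := by
  simp [approxTaylorSeries, hi]

theorem approxTaylorSeries_self (f : Vec n → ℝ) (x : Vec n) (T : Tensor n p) :
    approxTaylorSeries p f x T p = (1 / (p.factorial : ℝ)) • T := by
  simp [approxTaylorSeries]

theorem approxTaylorSeries_of_gt (f : Vec n → ℝ) (x : Vec n) (T : Tensor n p) {i : ℕ}
    (hi : p < i) : approxTaylorSeries p f x T i = 0 := by
  simp [approxTaylorSeries, hi.not_gt, hi.ne]

theorem hasFiniteFPowerSeriesOnBall_approxTaylor (hp : 0 < p) (f : Vec n → ℝ) (x : Vec n)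
    (T : Tensor n p) :
    HasFiniteFPowerSeriesOnBall (approxTaylor p f x T) (approxTaylorSeries p f x T) 0 (p + 1)
      ⊤ := by
  refine .mk' (fun i hi => approxTaylorSeries_of_gt f x T hi) (by simp) fun y _ => ?_
  have hIco : Finset.Ico (0 + 1) p = Finset.Icc 1 (p - 1) := by ext i; simp; omega
  rw [Finset.sum_range_succ, approxTaylorSeries_self, Finset.range_eq_Ico,
    Finset.sum_eq_sum_Ico_succ_bot hp, approxTaylorSeries_of_lt f x T hp, hIco, zero_add,
    approxTaylor]
  congr 2
  · simp
  · refine Finset.sum_congr rfl fun i hi => ?_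
    rw [approxTaylorSeries_of_lt f x T (by simp at hi; omega)]
    rfl

theorem contDiff_approxTaylor (hp : 0 < p) (f : Vec n → ℝ) (x : Vec n) (T : Tensor n p)
    {k : WithTop ℕ∞} : ContDiff ℝ k (approxTaylor p f x T) := by
  simpa [contDiffOn_univ] using
    (hasFiniteFPowerSeriesOnBall_approxTaylor hp f x T).cpolynomialOn.contDiffOn (n := k)

theorem norm_iteratedFDeriv_sub_approxTaylor_le (hp : 0 < p) {f : Vec n → ℝ}
    (hf : ContDiff ℝ p f) {L : ℝ} (hL : 0 ≤ L)
    (hlip : ∀ x y, ‖iteratedFDeriv ℝ p f x - iteratedFDeriv ℝ p f y‖ ≤ L * ‖x - y‖)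
    (x s : Vec n) (T : Tensor n p) {i : ℕ} (hi : i ≤ p) :
    ‖iteratedFDeriv ℝ i f (x + s) - iteratedFDeriv ℝ i (approxTaylor p f x T) s‖ ≤
      (L * ‖s‖ + ‖T - iteratedFDeriv ℝ p f x‖) * ‖s‖ ^ (p - i) := by
  have hcancel (j : ℕ) {A : Tensor n j} : j.factorial • ((1 / (j.factorial : ℝ)) • A) = A := by
    rw [← Nat.cast_smul_eq_nsmul ℝ, smul_smul, mul_one_div_cancel (by positivity), one_smul]
  simpa only [approxTaylorSeries_self, hcancel] using
    norm_iteratedFDeriv_sub_le_of_lipschitz hf hL hlip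
      (hasFiniteFPowerSeriesOnBall_approxTaylor hp f x T)
      (fun j hj => by rw [approxTaylorSeries_of_lt f x T hj, hcancel]) s hi

theorem norm_iteratedFDeriv_sub_approxTaylor_le_pow (hp : 0 < p) {f : Vec n → ℝ}
    (hf : ContDiff ℝ p f) {L : ℝ} (hL : 0 ≤ L)
    (hlip : ∀ x y, ‖iteratedFDeriv ℝ p f x - iteratedFDeriv ℝ p f y‖ ≤ L * ‖x - y‖)
    {x s : Vec n} {T : Tensor n p} {E V : ℝ} (hE : 0 ≤ E) (hV : 0 ≤ V)
    (hT : ‖T - iteratedFDeriv ℝ p f x‖ ≤ E * V) {i : ℕ} (hi : i ≤ p) :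
    ‖iteratedFDeriv ℝ i f (x + s) - iteratedFDeriv ℝ i (approxTaylor p f x T) s‖ ≤
      (L + E) * (‖s‖ + V) ^ (p + 1 - i) := by
  calc _ ≤ (L * ‖s‖ + ‖T - iteratedFDeriv ℝ p f x‖) * ‖s‖ ^ (p - i) :=
        norm_iteratedFDeriv_sub_approxTaylor_le hp hf hL hlip x s T hi
    _ ≤ (L * (‖s‖ + V) + E * (‖s‖ + V)) * (‖s‖ + V) ^ (p - i) := by
        gcongr
        · linarith
        · exact hT.trans (by gcongr; linarith [norm_nonneg s])
        · linarith
    _ = (L + E) * (‖s‖ + V) ^ (p + 1 - i) := by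
        rw [show p + 1 - i = p - i + 1 by omega, pow_succ]; ring

end ApproxTaylor

section Hessian

theorem sInf_hasEigenvalue_mul_norm_sq_le_inner {E : Type*} [NormedAddCommGroup E]
    [InnerProductSpace ℝ E] [FiniteDimensional ℝ E] {A : E →L[ℝ] E}
    (hA : (A : E →ₗ[ℝ] E).IsSymmetric) (v : E) :
    sInf {μ : ℝ | Module.End.HasEigenvalue (A : E →ₗ[ℝ] E) μ} * ‖v‖ ^ 2 ≤ inner ℝ (A v) v := by
  rcases eq_or_ne v 0 with rfl | hv
  · simp
  have : Nontrivial E := ⟨v, 0, hv⟩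
  have hbdd : BddBelow (Set.range fun y : {y : E // y ≠ 0} =>
      inner ℝ (A y) (y : E) / ‖(y : E)‖ ^ 2) := by
    refine ⟨-‖A‖, ?_⟩
    rintro _ ⟨y, rfl⟩
    exact neg_le_of_abs_le (A.rayleighQuotient_le_norm y)
  have hfinite : Set.Finite {μ : ℝ | Module.End.HasEigenvalue (A : E →ₗ[ℝ] E) μ} :=
    Module.End.finite_hasEigenvalue _
  rw [← le_div_iff₀ (by positivity)]
  exact (csInf_le hfinite.bddBelow hA.hasEigenvalue_iInf_of_finiteDimensional).trans
    (ciInf_le hbdd ⟨v, hv⟩)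

variable {n : ℕ} {F : Vec n → ℝ}

theorem inner_hessian (hF : ContDiff ℝ 2 F) (x u v : Vec n) :
    inner ℝ (hessian F x u) v = fderiv ℝ (fderiv ℝ F) x u v := by
  let D : StrongDual ℝ (Vec n) →L[ℝ] Vec n :=
    (InnerProductSpace.toDual ℝ (Vec n)).symm.toContinuousLinearEquiv.toContinuousLinearMap
  have hdiff : DifferentiableAt ℝ (fderiv ℝ F) x :=
    (hF.fderiv_right (m := 1) (by norm_num)).differentiable (by norm_num) x
  have hcomp : hessian F x = D.comp (fderiv ℝ (fderiv ℝ F) x) :=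
    (D.hasFDerivAt.comp x hdiff.hasFDerivAt).fderiv
  rw [hcomp]
  exact InnerProductSpace.toDual_symm_apply

theorem inner_hessian_self (hF : ContDiff ℝ 2 F) (x v : Vec n) :
    inner ℝ (hessian F x v) v = iteratedFDeriv ℝ 2 F x fun _ => v := by
  rw [inner_hessian hF, iteratedFDeriv_two_apply]

theorem isSymmetric_hessian (hF : ContDiff ℝ 2 F) (x : Vec n) :
    (hessian F x : Vec n →ₗ[ℝ] Vec n).IsSymmetric := by
  intro u v
  rw [ContinuousLinearMap.coe_coe, real_inner_comm (hessian F x v) u, inner_hessian hF,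
    inner_hessian hF]
  exact hF.contDiffAt.isSymmSndFDerivAt (by simp) u v

theorem negCurv_nonneg (F : Vec n → ℝ) (x : Vec n) : 0 ≤ negCurv F x := le_max_left _ _

theorem neg_negCurv_mul_le (hF : ContDiff ℝ 2 F) (x v : Vec n) :
    -(negCurv F x * ‖v‖ ^ 2) ≤ iteratedFDeriv ℝ 2 F x fun _ => v := by
  rw [← inner_hessian_self hF, neg_mul_eq_neg_mul]
  refine le_trans ?_ (sInf_hasEigenvalue_mul_norm_sq_le_inner (isSymmetric_hessian hF x) v)
  gcongr
  exact neg_le.mp (le_max_right _ _)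

theorem negCurv_le_iff (hF : ContDiff ℝ 2 F) {x : Vec n} {c : ℝ} (hc : 0 ≤ c) :
    negCurv F x ≤ c ↔ ∀ v : Vec n, -(c * ‖v‖ ^ 2) ≤ iteratedFDeriv ℝ 2 F x fun _ => v := by
  refine ⟨fun h v => le_trans (by gcongr) (neg_negCurv_mul_le hF x v), fun h =>
    max_le hc (neg_le.mp ?_)⟩
  rcases Set.eq_empty_or_nonempty
    {μ : ℝ | Module.End.HasEigenvalue (hessian F x : Vec n →ₗ[ℝ] Vec n) μ} with hempty | hne
  · rw [lambdaMin, hempty, Real.sInf_empty]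
    exact neg_nonpos.mpr hc
  · refine le_csInf hne fun μ hμ => ?_
    obtain ⟨v, hv⟩ := hμ.exists_hasEigenvector
    have hv0 : 0 < ‖v‖ := norm_pos_iff.mpr hv.2
    have hquad := h v
    rw [← inner_hessian_self hF, show hessian F x v = μ • v from hv.apply_eq_smul,
      real_inner_smul_left, real_inner_self_eq_norm_sq, neg_mul_eq_neg_mul] at hquad
    exact le_of_mul_le_mul_right hquad (by positivity)

theorem negCurv_le_add_norm_sub {G : Vec n → ℝ} (hF : ContDiff ℝ 2 F) (hG : ContDiff ℝ 2 G)
    (x y : Vec n) :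
    negCurv F x ≤ negCurv G y + ‖iteratedFDeriv ℝ 2 F x - iteratedFDeriv ℝ 2 G y‖ := by
  refine (negCurv_le_iff hF (add_nonneg (negCurv_nonneg G y) (norm_nonneg _))).mpr fun v => ?_
  have hdiff := (iteratedFDeriv ℝ 2 F x - iteratedFDeriv ℝ 2 G y).le_opNorm fun _ => v
  simp only [sub_apply, Finset.prod_const, Finset.card_univ, Fintype.card_fin] at hdiff
  linarith [neg_le_of_abs_le hdiff, neg_negCurv_mul_le hG y v]

theorem norm_gradient_sub_le (F G : Vec n → ℝ) (x y : Vec n) :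
    ‖∇ F x - ∇ G y‖ ≤ ‖iteratedFDeriv ℝ 1 F x - iteratedFDeriv ℝ 1 G y‖ := by
  rw [gradient, gradient, ← map_sub, LinearIsometryEquiv.norm_map]
  refine ContinuousLinearMap.opNorm_le_bound _ (norm_nonneg _) fun v => ?_
  simpa [iteratedFDeriv_one_apply] using
    (iteratedFDeriv ℝ 1 F x - iteratedFDeriv ℝ 1 G y).le_opNorm fun _ => v

theorem neg_norm_gradient_mul_le (F : Vec n → ℝ) (x v : Vec n) :
    -(‖∇ F x‖ * ‖v‖) ≤ iteratedFDeriv ℝ 1 F x fun _ => v := by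
  have happly : iteratedFDeriv ℝ 1 F x (fun _ => v) = inner ℝ (∇ F x) v := by
    rw [iteratedFDeriv_one_apply, gradient, InnerProductSpace.toDual_symm_apply]
  rw [happly]
  exact neg_le_of_abs_le (abs_real_inner_le_norm _ _)

end Hessian

theorem norm_averagedTensor_sub_le {n p : ℕ} {f : Vec n → ℝ} (hf : ContDiff ℝ p f) {L : ℝ}
    (hL : 0 ≤ L)
    (hlip : ∀ x y, ‖iteratedFDeriv ℝ p f x - iteratedFDeriv ℝ p f y‖ ≤ L * ‖x - y‖)
    (x s : Vec n) {a : ℝ} (ha : a ∈ Set.Icc (0 : ℝ) 1) :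
    ‖averagedTensor p f x s - iteratedFDeriv ℝ p f (x + a • s)‖ ≤ L * ‖s‖ := by
  have hcont : Continuous fun t : ℝ => iteratedFDeriv ℝ p f (x + t • s) :=
    (hf.continuous_iteratedFDeriv le_rfl).comp (by fun_prop)
  have hsub : averagedTensor p f x s - iteratedFDeriv ℝ p f (x + a • s) =
      ∫ t in (0 : ℝ)..1, (iteratedFDeriv ℝ p f (x + t • s) - iteratedFDeriv ℝ p f (x + a • s)) := by
    rw [intervalIntegral.integral_sub (hcont.intervalIntegrable _ _) (by simp)]
    simp [averagedTensor]
  have hbound : ∀ t ∈ Set.uIoc (0 : ℝ) 1,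
      ‖iteratedFDeriv ℝ p f (x + t • s) - iteratedFDeriv ℝ p f (x + a • s)‖ ≤ L * ‖s‖ := by
    intro t ht
    rw [Set.uIoc_of_le zero_le_one] at ht
    have hta : |t - a| ≤ 1 :=
      abs_sub_le_iff.mpr ⟨by linarith [ht.2, ha.1], by linarith [ht.1, ha.2]⟩
    calc _ ≤ L * ‖x + t • s - (x + a • s)‖ := hlip _ _
      _ = L * (|t - a| * ‖s‖) := by
        rw [add_sub_add_left_eq_sub, ← sub_smul, norm_smul, Real.norm_eq_abs]
      _ ≤ L * ‖s‖ := by gcongr; exact mul_le_of_le_one_left (norm_nonneg s) hta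
  rw [hsub]
  simpa using intervalIntegral.norm_integral_le_of_norm_le_const hbound

section Growth

variable {σ ρ : ℕ → ℝ}

theorem sum_range_mul_eq_sub_of_succ_eq (hσ : ∀ k, σ (k + 1) = σ k + σ k * ρ k) (k : ℕ) :
    ∑ j ∈ Finset.range k, σ j * ρ j = σ k - σ 0 := by
  rw [← Finset.sum_range_sub]
  exact Finset.sum_congr rfl fun j _ => (sub_eq_of_eq_add' (hσ j)).symm

theorem pos_of_succ_eq (hσ : ∀ k, σ (k + 1) = σ k + σ k * ρ k) (hσ₀ : 0 < σ 0)
    (hρ : ∀ k, 0 ≤ ρ k) (k : ℕ) : 0 < σ k := by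
  induction k with
  | zero => exact hσ₀
  | succ k ih =>
    rw [hσ]
    exact add_pos_of_pos_of_nonneg ih (mul_nonneg ih.le (hρ k))

theorem monotone_of_succ_eq (hσ : ∀ k, σ (k + 1) = σ k + σ k * ρ k) (hσ₀ : 0 < σ 0)
    (hρ : ∀ k, 0 ≤ ρ k) : Monotone σ :=
  monotone_nat_of_le_succ fun k => by
    rw [hσ]
    exact le_add_of_nonneg_right (mul_nonneg (pos_of_succ_eq hσ hσ₀ hρ k).le (hρ k))

theorem sum_range_le_div_of_succ_eq (hσ : ∀ k, σ (k + 1) = σ k + σ k * ρ k) (hσ₀ : 0 < σ 0)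
    (hρ : ∀ k, 0 ≤ ρ k) (k : ℕ) : ∑ j ∈ Finset.range k, ρ j ≤ σ k / σ 0 := by
  rw [le_div_iff₀' hσ₀, Finset.mul_sum]
  calc ∑ j ∈ Finset.range k, σ 0 * ρ j ≤ ∑ j ∈ Finset.range k, σ j * ρ j :=
        Finset.sum_le_sum fun j _ => mul_le_mul_of_nonneg_right
          (monotone_of_succ_eq hσ hσ₀ hρ j.zero_le) (hρ j)
    _ ≤ σ k := by rw [sum_range_mul_eq_sub_of_succ_eq hσ]; linarith

/- Above the level `2 * A` each increment `σ k * ρ k` of `σ` is at most twice the summand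
`(σ k - A) * ρ k`; below that level the next term is at most `S`. -/
theorem half_le_add_sum_of_succ_eq (hσ : ∀ k, σ (k + 1) = σ k + σ k * ρ k) (hσ₀ : 0 < σ 0)
    (hρ : ∀ k, 0 ≤ ρ k) {A S : ℝ} (hA : 0 ≤ A) (hS : σ 0 ≤ S)
    (hstep : ∀ k, σ k ≤ 2 * A → σ (k + 1) ≤ S) (k : ℕ) :
    σ k / 2 ≤ S / 2 + A * (S / σ 0) + ∑ j ∈ Finset.range k, (σ j - A) * ρ j := by
  induction k with
  | zero =>
    have : 0 ≤ A * (S / σ 0) := mul_nonneg hA (div_nonneg (hσ₀.le.trans hS) hσ₀.le)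
    simpa using by linarith
  | succ k ih =>
    rcases le_total (σ k) (2 * A) with hlow | hhigh
    · have hsum : A * ∑ j ∈ Finset.range (k + 1), ρ j ≤ A * (S / σ 0) := by
        gcongr
        exact (sum_range_le_div_of_succ_eq hσ hσ₀ hρ _).trans (by gcongr; exact hstep k hlow)
      simp only [sub_mul, Finset.sum_sub_distrib, ← Finset.mul_sum,
        sum_range_mul_eq_sub_of_succ_eq hσ]
      linarith [hstep k hlow, monotone_of_succ_eq hσ hσ₀ hρ (k + 1).zero_le]
    · have : 0 ≤ (σ k / 2 - A) * ρ k := mul_nonneg (by linarith) (hρ k)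
      rw [Finset.sum_range_succ, hσ]
      linarith

end Growth

section Rates

theorem le_one_add_of_pow_succ_le {y Q : ℝ} {p : ℕ} (hQ : 0 ≤ Q) (h : y ^ (p + 1) ≤ Q) :
    y ≤ 1 + Q := by
  rcases le_total y 1 with hy | hy
  · linarith
  · linarith [le_self_pow₀ hy p.add_one_ne_zero]

theorem rpow_le_one_add {B a : ℝ} (hB : 0 ≤ B) (ha0 : 0 ≤ a) (ha1 : a ≤ 1) : B ^ a ≤ 1 + B := by
  rcases le_total B 1 with h | h
  · linarith [Real.rpow_le_one hB h ha0]
  · linarith [Real.rpow_le_self_of_one_le h ha1]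

theorem pow_le_mul_rpow_neg_of_pow_le_div {W B y : ℝ} {i q : ℕ} (hW : 0 ≤ W) (hB : 0 ≤ B)
    (hy : 0 < y) (hq : 0 < q) (hi : i ≤ q) (h : W ^ q ≤ B / y) :
    W ^ i ≤ (1 + B) * y ^ (-((i : ℝ) / q)) := by
  have hq' : (0 : ℝ) < q := by exact_mod_cast hq
  calc W ^ i = (W ^ q) ^ ((i : ℝ) / q) := by
        rw [← Real.rpow_natCast W q, ← Real.rpow_mul hW, mul_div_cancel₀ _ hq'.ne',
          Real.rpow_natCast]
    _ ≤ (B / y) ^ ((i : ℝ) / q) := by gcongr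
    _ = B ^ ((i : ℝ) / q) * y ^ (-((i : ℝ) / q)) := by
        rw [Real.div_rpow hB hy.le, Real.rpow_neg hy.le, div_eq_mul_inv]
    _ ≤ (1 + B) * y ^ (-((i : ℝ) / q)) := by
        gcongr
        exact rpow_le_one_add hB (by positivity)
          (div_le_one_of_le₀ (by exact_mod_cast hi) hq'.le)

theorem mul_rpow_neg_le_of_rpow_inv_mul_le {a C ε y : ℝ} (ha : 0 < a) (hC : 0 < C) (hε : 0 < ε)
    (h : C ^ a⁻¹ * ε ^ (-a⁻¹) ≤ y) : C * y ^ (-a) ≤ ε := by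
  have hy : 0 < y := lt_of_lt_of_le (by positivity) h
  rw [Real.rpow_neg hε.le, ← div_eq_mul_inv, ← Real.div_rpow hC.le hε.le,
    Real.rpow_inv_le_iff_of_pos (by positivity) hy.le ha, div_le_iff₀' hε] at h
  rwa [Real.rpow_neg hy.le, ← div_eq_mul_inv, div_le_iff₀' (by positivity), mul_comm]

theorem exists_index_of_rates {a₁ a₂ C ε₁ ε₂ : ℝ} (ha₁ : 0 < a₁) (ha₂ : 0 < a₂) (hC : 0 < C)
    (hε₁ : 0 < ε₁) (hε₂ : 0 < ε₂) {g b : ℕ → ℝ} (hg0 : g 0 ≤ C) (hb0 : b 0 ≤ C)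
    (h : ∀ k : ℕ, ∃ j ∈ Finset.Icc 1 (k + 1),
      g j ≤ C * ((k : ℝ) + 1) ^ (-a₁) ∧ b j ≤ C * ((k : ℝ) + 1) ^ (-a₂)) :
    ∃ j : ℕ, (j : ℝ) ≤ 2 * (C ^ a₁⁻¹ + C ^ a₂⁻¹) * max (ε₁ ^ (-a₁⁻¹)) (ε₂ ^ (-a₂⁻¹)) ∧
      g j ≤ ε₁ ∧ b j ≤ ε₂ := by
  set Y := (C ^ a₁⁻¹ + C ^ a₂⁻¹) * max (ε₁ ^ (-a₁⁻¹)) (ε₂ ^ (-a₂⁻¹)) with hY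
  have hY₁ : C ^ a₁⁻¹ * ε₁ ^ (-a₁⁻¹) ≤ Y := by
    rw [hY]; gcongr
    · linarith [Real.rpow_pos_of_pos hC a₂⁻¹]
    · exact le_max_left _ _
  have hY₂ : C ^ a₂⁻¹ * ε₂ ^ (-a₂⁻¹) ≤ Y := by
    rw [hY]; gcongr
    · linarith [Real.rpow_pos_of_pos hC a₁⁻¹]
    · exact le_max_right _ _
  have hY0 : 0 < Y := lt_of_lt_of_le (by positivity) hY₁
  rw [mul_assoc, ← hY]
  rcases lt_or_ge Y 1 with hY1 | hY1
  · have hg := mul_rpow_neg_le_of_rpow_inv_mul_le ha₁ hC hε₁ (hY₁.trans hY1.le)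
    have hb := mul_rpow_neg_le_of_rpow_inv_mul_le ha₂ hC hε₂ (hY₂.trans hY1.le)
    rw [Real.one_rpow, mul_one] at hg hb
    exact ⟨0, by simpa using hY0.le, hg0.trans hg, hb0.trans hb⟩
  · obtain ⟨j, hj, hgj, hbj⟩ := h ⌊Y⌋₊
    have hfloor : Y ≤ (⌊Y⌋₊ : ℝ) + 1 := (Nat.lt_floor_add_one Y).le
    have hj' : (j : ℝ) ≤ ⌊Y⌋₊ + 1 := by exact_mod_cast (Finset.mem_Icc.mp hj).2
    exact ⟨j, by linarith [Nat.floor_le hY0.le],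
      hgj.trans (mul_rpow_neg_le_of_rpow_inv_mul_le ha₁ hC hε₁ (hY₁.trans hfloor)),
      hbj.trans (mul_rpow_neg_le_of_rpow_inv_mul_le ha₂ hC hε₂ (hY₂.trans hfloor))⟩

end Rates

/-- The scalar sequences along a run of the algorithm and the inequalities between them on which
the complexity analysis rests: the gap `f(x_k) - f_low`, the gradient norm, the negative curvature,
the regularization parameter, the step length and the sum of the lengths of a fixed number of
previous steps (`window`). The constant `K` collects the smoothness constants and the tolerances of
the algorithm, `M` the length of the window, and `G` bounds the initial values. -/
structure ScalarRun (p : ℕ) (K M G σ₀ : ℝ) where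
  gap : ℕ → ℝ
  grad : ℕ → ℝ
  curv : ℕ → ℝ
  sigma : ℕ → ℝ
  step : ℕ → ℝ
  window : ℕ → ℝ
  gap_nonneg : ∀ k, 0 ≤ gap k
  step_nonneg : ∀ k, 0 ≤ step k
  window_nonneg : ∀ k, 0 ≤ window k
  gap_zero : gap 0 ≤ G
  grad_zero : grad 0 ≤ G
  curv_zero : curv 0 ≤ G
  window_zero : window 0 ≤ G
  sigma_zero : sigma 0 = σ₀
  sigma_succ : ∀ k, sigma (k + 1) = sigma k + sigma k * step k ^ (p + 1)
  window_succ : ∀ k, window (k + 1) ≤ step k + window k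
  sum_window : ∀ k, ∑ j ∈ Finset.range k, (step j + window j) ^ (p + 1) ≤
    M * (1 + ∑ j ∈ Finset.range k, step j ^ (p + 1))
  gap_succ : ∀ k, gap (k + 1) ≤ gap k - sigma k * step k ^ (p + 1) / ((p + 1).factorial : ℝ) +
    K * (step k + window k) ^ (p + 1)
  grad_succ : ∀ k, grad (k + 1) ≤ K * (1 + sigma k) * (step k + window k) ^ p
  curv_succ : ∀ k, curv (k + 1) ≤ K * (1 + sigma k) * (step k + window k) ^ (p - 1)
  step_le : ∀ k, 1 ≤ step k → sigma k * step k ≤ K * (1 + grad k + curv k + window k)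

namespace ScalarRun

variable {p : ℕ} {K M G σ₀ : ℝ}

theorem step_pow_nonneg (R : ScalarRun p K M G σ₀) (k : ℕ) : 0 ≤ R.step k ^ (p + 1) :=
  pow_nonneg (R.step_nonneg k) _

theorem step_add_window_nonneg (R : ScalarRun p K M G σ₀) (k : ℕ) : 0 ≤ R.step k + R.window k :=
  add_nonneg (R.step_nonneg k) (R.window_nonneg k)

theorem sigma_pos (R : ScalarRun p K M G σ₀) (hσ₀ : 0 < σ₀) (k : ℕ) : 0 < R.sigma k :=
  pos_of_succ_eq R.sigma_succ (hσ₀.trans_eq R.sigma_zero.symm) R.step_pow_nonneg k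

theorem sigma_monotone (R : ScalarRun p K M G σ₀) (hσ₀ : 0 < σ₀) : Monotone R.sigma :=
  monotone_of_succ_eq R.sigma_succ (hσ₀.trans_eq R.sigma_zero.symm) R.step_pow_nonneg

theorem sum_window_le (R : ScalarRun p K M G σ₀) (hM : 0 ≤ M) (hσ₀ : 0 < σ₀) {k : ℕ} {S : ℝ}
    (hS : R.sigma k ≤ S) :
    ∑ j ∈ Finset.range k, (R.step j + R.window j) ^ (p + 1) ≤ M * (1 + S / σ₀) := by
  have hsum := sum_range_le_div_of_succ_eq R.sigma_succ (hσ₀.trans_eq R.sigma_zero.symm)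
    R.step_pow_nonneg k
  rw [R.sigma_zero] at hsum
  calc _ ≤ M * (1 + ∑ j ∈ Finset.range k, R.step j ^ (p + 1)) := R.sum_window k
    _ ≤ M * (1 + S / σ₀) := by gcongr; exact hsum.trans (by gcongr)

theorem step_add_window_le (R : ScalarRun p K M G σ₀) (hM : 0 ≤ M) (hσ₀ : 0 < σ₀) {k : ℕ} {S : ℝ}
    (hS : R.sigma (k + 1) ≤ S) : R.step k + R.window k ≤ 1 + M * (1 + S / σ₀) := by
  have hS0 : 0 ≤ S := (R.sigma_pos hσ₀ _).le.trans hS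
  refine le_one_add_of_pow_succ_le (p := p) (by positivity)
    (le_trans ?_ (R.sum_window_le hM hσ₀ hS))
  exact Finset.single_le_sum (f := fun j => (R.step j + R.window j) ^ (p + 1))
    (fun j _ => pow_nonneg (R.step_add_window_nonneg j) _) (Finset.self_mem_range_succ k)

theorem sum_sigma_mul_step_pow_div_le (R : ScalarRun p K M G σ₀) (k : ℕ) :
    (∑ j ∈ Finset.range k, R.sigma j * R.step j ^ (p + 1)) / ((p + 1).factorial : ℝ) ≤
      G + K * ∑ j ∈ Finset.range k, (R.step j + R.window j) ^ (p + 1) - R.gap k := by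
  induction k with
  | zero => simpa using R.gap_zero
  | succ k ih =>
    rw [Finset.sum_range_succ, Finset.sum_range_succ, add_div, mul_add]
    linarith [R.gap_succ k]

theorem sum_sigma_sub_mul_step_pow_le (R : ScalarRun p K M G σ₀) (hK : 0 ≤ K) (k : ℕ) :
    ∑ j ∈ Finset.range k, (R.sigma j - (p + 1).factorial * K * M) * R.step j ^ (p + 1) ≤
      (p + 1).factorial * (G + K * M) := by
  have hdecrease := R.sum_sigma_mul_step_pow_div_le k
  rw [div_le_iff₀' (by positivity)] at hdecrease
  have hwindow : (p + 1).factorial *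
      (G + K * ∑ j ∈ Finset.range k, (R.step j + R.window j) ^ (p + 1) - R.gap k) ≤
      (p + 1).factorial * (G + K * (M * (1 + ∑ j ∈ Finset.range k, R.step j ^ (p + 1)))) := by
    gcongr
    have := R.sum_window k
    exact (sub_le_self _ (R.gap_nonneg k)).trans (by gcongr)
  simp only [sub_mul, Finset.sum_sub_distrib, ← Finset.mul_sum]
  linarith

theorem exists_grad_curv_window_bound (p : ℕ) {K M G σ₀ A : ℝ} (hK : 0 ≤ K) (hM : 0 ≤ M)
    (hG : 0 ≤ G) (hσ₀ : 0 < σ₀) (hA : 0 ≤ A) :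
    ∃ D : ℝ, 0 ≤ D ∧ ∀ (R : ScalarRun p K M G σ₀) (k : ℕ), R.sigma k ≤ A →
      R.grad k ≤ D ∧ R.curv k ≤ D ∧ R.window k ≤ D := by
  set W := 1 + M * (1 + A / σ₀)
  have hW1 : 1 ≤ W := le_add_of_nonneg_right (by positivity)
  have hD : 0 ≤ K * (1 + A) * W ^ p := by positivity
  refine ⟨G + K * (1 + A) * W ^ p + W, by positivity, fun R k hk => ?_⟩
  cases k with
  | zero =>
    exact ⟨by linarith [R.grad_zero], by linarith [R.curv_zero], by linarith [R.window_zero]⟩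
  | succ k =>
    have hsigma : R.sigma k ≤ A := (R.sigma_monotone hσ₀ k.le_succ).trans hk
    have hstep := R.step_add_window_le hM hσ₀ hk
    have hstep0 := R.step_add_window_nonneg k
    have hpow (i : ℕ) (hi : i ≤ p) :
        K * (1 + R.sigma k) * (R.step k + R.window k) ^ i ≤ K * (1 + A) * W ^ p := by
      have : (R.step k + R.window k) ^ i ≤ W ^ p :=
        (pow_le_pow_left₀ hstep0 hstep i).trans (pow_le_pow_right₀ hW1 hi)
      gcongr
    exact ⟨by linarith [R.grad_succ k, hpow p le_rfl],
      by linarith [R.curv_succ k, hpow (p - 1) (Nat.sub_le p 1)], by linarith [R.window_succ k]⟩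

theorem exists_step_bound (p : ℕ) {K M G σ₀ A : ℝ} (hK : 0 ≤ K) (hM : 0 ≤ M) (hG : 0 ≤ G)
    (hσ₀ : 0 < σ₀) (hA : 0 ≤ A) :
    ∃ r : ℝ, 0 ≤ r ∧ ∀ (R : ScalarRun p K M G σ₀) (k : ℕ), R.sigma k ≤ A → R.step k ≤ r := by
  obtain ⟨D, hD0, hD⟩ := exists_grad_curv_window_bound p hK hM hG hσ₀ hA
  have hbound : 0 ≤ K * (1 + D + D + D) / σ₀ := by positivity
  refine ⟨1 + K * (1 + D + D + D) / σ₀, by positivity, fun R k hk => ?_⟩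
  rcases le_total (R.step k) 1 with hr | hr
  · linarith
  · obtain ⟨hgrad, hcurv, hwindow⟩ := hD R k hk
    have hsigma : σ₀ ≤ R.sigma k := R.sigma_zero.ge.trans (R.sigma_monotone hσ₀ k.zero_le)
    suffices R.step k ≤ K * (1 + D + D + D) / σ₀ by linarith
    rw [le_div_iff₀' hσ₀]
    calc σ₀ * R.step k ≤ R.sigma k * R.step k := mul_le_mul_of_nonneg_right hsigma (R.step_nonneg k)
      _ ≤ K * (1 + R.grad k + R.curv k + R.window k) := R.step_le k hr
      _ ≤ K * (1 + D + D + D) := by gcongr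

theorem exists_sigma_bound (p : ℕ) {K M G σ₀ : ℝ} (hK : 0 ≤ K) (hM : 0 ≤ M) (hG : 0 ≤ G)
    (hσ₀ : 0 < σ₀) :
    ∃ S : ℝ, 0 ≤ S ∧ ∀ (R : ScalarRun p K M G σ₀) (k : ℕ), R.sigma k ≤ S := by
  set A := (p + 1).factorial * K * M
  have hA0 : 0 ≤ A := by positivity
  obtain ⟨r, hr0, hr⟩ := exists_step_bound p hK hM hG hσ₀ (mul_nonneg zero_le_two hA0)
  set S := σ₀ + 2 * A * (1 + r ^ (p + 1)) with hS
  have hgrowth (R : ScalarRun p K M G σ₀) (k : ℕ) (hk : R.sigma k ≤ 2 * A) :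
      R.sigma (k + 1) ≤ S := by
    have hpow : R.step k ^ (p + 1) ≤ r ^ (p + 1) :=
      pow_le_pow_left₀ (R.step_nonneg k) (hr R k hk) _
    calc R.sigma (k + 1) = R.sigma k * (1 + R.step k ^ (p + 1)) := by rw [R.sigma_succ]; ring
      _ ≤ 2 * A * (1 + r ^ (p + 1)) := by
        gcongr
        exact add_nonneg zero_le_one (R.step_pow_nonneg k)
      _ ≤ S := by linarith
  refine ⟨2 * (S / 2 + A * (S / σ₀) + (p + 1).factorial * (G + K * M)), by positivity,
    fun R k => ?_⟩
  have hzero : R.sigma 0 ≤ S := by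
    rw [R.sigma_zero, hS]
    exact le_add_of_nonneg_right (by positivity)
  have hhalf := half_le_add_sum_of_succ_eq R.sigma_succ (hσ₀.trans_eq R.sigma_zero.symm)
    R.step_pow_nonneg hA0 hzero (hgrowth R) k
  rw [R.sigma_zero] at hhalf
  linarith [R.sum_sigma_sub_mul_step_pow_le hK k]

theorem exists_step_add_window_pow_le_div (p : ℕ) {K M G σ₀ : ℝ} (hK : 0 ≤ K) (hM : 0 ≤ M)
    (hG : 0 ≤ G) (hσ₀ : 0 < σ₀) :
    ∃ B : ℝ, 0 ≤ B ∧ ∀ (R : ScalarRun p K M G σ₀) (k : ℕ), R.sigma k ≤ B ∧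
      ∃ j ∈ Finset.range (k + 1), (R.step j + R.window j) ^ (p + 1) ≤ B / ((k : ℝ) + 1) := by
  obtain ⟨S, hS0, hS⟩ := exists_sigma_bound p hK hM hG hσ₀
  have hB0 : 0 ≤ M * (1 + S / σ₀) := by positivity
  refine ⟨S + M * (1 + S / σ₀), by positivity, fun R k =>
    ⟨by linarith [hS R k], Finset.exists_le_of_sum_le (by simp) ?_⟩⟩
  rw [Finset.sum_const, Finset.card_range, nsmul_eq_mul, Nat.cast_succ,
    mul_div_cancel₀ _ (by positivity)]
  linarith [R.sum_window_le hM hσ₀ (hS R (k + 1))]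

theorem exists_rate {p : ℕ} (hp : 1 ≤ p) {K M G σ₀ : ℝ} (hK : 0 ≤ K) (hM : 0 ≤ M) (hG : 0 ≤ G)
    (hσ₀ : 0 < σ₀) :
    ∃ C : ℝ, 0 ≤ C ∧ ∀ (R : ScalarRun p K M G σ₀) (k : ℕ), ∃ j ∈ Finset.Icc 1 (k + 1),
      R.grad j ≤ C * ((k : ℝ) + 1) ^ (-((p : ℝ) / ((p : ℝ) + 1))) ∧
      R.curv j ≤ C * ((k : ℝ) + 1) ^ (-(((p : ℝ) - 1) / ((p : ℝ) + 1))) := by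
  obtain ⟨B, hB0, hB⟩ := exists_step_add_window_pow_le_div p hK hM hG hσ₀
  refine ⟨K * (1 + B) * (1 + B), by positivity, fun R k => ?_⟩
  obtain ⟨j, hj, hjB⟩ := (hB R k).2
  have hrate (i : ℕ) (hi : i ≤ p) : K * (1 + R.sigma j) * (R.step j + R.window j) ^ i ≤
      K * (1 + B) * (1 + B) * ((k : ℝ) + 1) ^ (-((i : ℝ) / ((p : ℝ) + 1))) := by
    have hpow := pow_le_mul_rpow_neg_of_pow_le_div (R.step_add_window_nonneg j) hB0
      (by positivity) p.succ_pos (hi.trans p.le_succ) hjB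
    have hsigma : R.sigma j ≤ B := (hB R j).1
    have hnonneg := R.step_add_window_nonneg j
    rw [mul_assoc (K * (1 + B))]
    push_cast at hpow
    gcongr
  refine ⟨j + 1, by simpa [Nat.lt_succ_iff] using hj, (R.grad_succ j).trans (hrate p le_rfl), ?_⟩
  simpa [Nat.cast_sub hp] using (R.curv_succ j).trans (hrate (p - 1) (Nat.sub_le p 1))

theorem exists_complexity_bound {p : ℕ} (hp : 2 ≤ p) {K M G σ₀ : ℝ} (hK : 0 ≤ K) (hM : 0 ≤ M)
    (hG : 0 ≤ G) (hσ₀ : 0 < σ₀) :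
    ∃ C : ℝ, 0 < C ∧ ∀ R : ScalarRun p K M G σ₀,
      (∀ k : ℕ, ∃ j ∈ Finset.Icc 1 (k + 1),
        R.grad j ≤ C * ((k : ℝ) + 1) ^ (-((p : ℝ) / ((p : ℝ) + 1))) ∧
        R.curv j ≤ C * ((k : ℝ) + 1) ^ (-(((p : ℝ) - 1) / ((p : ℝ) + 1)))) ∧
      ∀ ε₁ ε₂ : ℝ, 0 < ε₁ → 0 < ε₂ → ∃ j : ℕ,
        (j : ℝ) ≤ C * max (ε₁ ^ (-(((p : ℝ) + 1) / (p : ℝ))))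
          (ε₂ ^ (-(((p : ℝ) + 1) / ((p : ℝ) - 1)))) ∧
        R.grad j ≤ ε₁ ∧ R.curv j ≤ ε₂ := by
  obtain ⟨C₀, hC₀, hrate⟩ := exists_rate (by omega : 1 ≤ p) hK hM hG hσ₀
  have hp' : (2 : ℝ) ≤ p := by exact_mod_cast hp
  set a₁ : ℝ := (p : ℝ) / ((p : ℝ) + 1)
  set a₂ : ℝ := ((p : ℝ) - 1) / ((p : ℝ) + 1)
  have ha₁ : 0 < a₁ := by positivity
  have ha₂ : 0 < a₂ := div_pos (by linarith) (by linarith)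
  set C₁ := C₀ + G + 1
  have hC₁ : 0 < C₁ := by positivity
  set C₂ := 2 * (C₁ ^ a₁⁻¹ + C₁ ^ a₂⁻¹)
  have hC₂ : 0 < C₂ := by positivity
  have hrate_mono {C : ℝ} (hC : C₀ ≤ C) (R : ScalarRun p K M G σ₀) (k : ℕ) :
      ∃ j ∈ Finset.Icc 1 (k + 1),
        R.grad j ≤ C * ((k : ℝ) + 1) ^ (-a₁) ∧ R.curv j ≤ C * ((k : ℝ) + 1) ^ (-a₂) := by
    obtain ⟨j, hj, hgrad, hcurv⟩ := hrate R k
    exact ⟨j, hj, hgrad.trans (by gcongr), hcurv.trans (by gcongr)⟩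
  refine ⟨C₁ + C₂, by positivity, fun R => ⟨hrate_mono (by linarith) R, fun ε₁ ε₂ hε₁ hε₂ => ?_⟩⟩
  obtain ⟨j, hj, hgrad, hcurv⟩ := exists_index_of_rates ha₁ ha₂ hC₁ hε₁ hε₂
    (by linarith [R.grad_zero]) (by linarith [R.curv_zero]) (hrate_mono (by linarith) R)
  have hjC : (j : ℝ) ≤ (C₁ + C₂) * max (ε₁ ^ (-a₁⁻¹)) (ε₂ ^ (-a₂⁻¹)) :=
    hj.trans (by gcongr; linarith)
  rw [inv_div, inv_div] at hjC
  exact ⟨j, hjC, hgrad, hcurv⟩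

end ScalarRun

section Window

variable {n : ℕ}

theorem stepLength_natCast (s : ℕ → Vec n) (k : ℕ) : stepLength s (k : ℤ) = ‖s k‖ := by
  simp [stepLength]

theorem stepLength_of_neg (s : ℕ → Vec n) {j : ℤ} (hj : j < 0) : stepLength s j = 1 :=
  if_neg hj.not_ge

theorem stepLength_nonneg (s : ℕ → Vec n) (j : ℤ) : 0 ≤ stepLength s j := by
  unfold stepLength
  split_ifs <;> simp

theorem sum_stepLength_sub_pow_le (s : ℕ → Vec n) (q k i : ℕ) :
    ∑ j ∈ Finset.range k, stepLength s ((j : ℤ) - (i : ℤ)) ^ q ≤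
      i + ∑ j ∈ Finset.range k, ‖s j‖ ^ q := by
  induction i with
  | zero => simp [stepLength_natCast]
  | succ i ih =>
    calc ∑ j ∈ Finset.range k, stepLength s ((j : ℤ) - ((i + 1 : ℕ) : ℤ)) ^ q
        ≤ ∑ j ∈ Finset.range (k + 1), stepLength s ((j : ℤ) - ((i + 1 : ℕ) : ℤ)) ^ q :=
          Finset.sum_le_sum_of_subset_of_nonneg (Finset.range_mono k.le_succ)
            fun j _ _ => pow_nonneg (stepLength_nonneg s _) q
      _ = ∑ j ∈ Finset.range k, stepLength s ((j : ℤ) - (i : ℤ)) ^ q + 1 := by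
          rw [Finset.sum_range_succ', stepLength_of_neg s (by omega), one_pow]
          simp only [Nat.cast_succ, add_sub_add_right_eq_sub]
      _ ≤ (i + 1 : ℕ) + ∑ j ∈ Finset.range k, ‖s j‖ ^ q := by
          push_cast
          linarith

/-- The sum of the lengths of the `N` steps before the step `k`, in terms of which the tensor
approximation errors are controlled. -/
def window (s : ℕ → Vec n) (N k : ℕ) : ℝ :=
  ∑ i ∈ Finset.Icc 1 N, stepLength s ((k : ℤ) - (i : ℤ))

theorem window_nonneg (s : ℕ → Vec n) (N k : ℕ) : 0 ≤ window s N k :=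
  Finset.sum_nonneg fun _ _ => stepLength_nonneg s _

theorem window_mono (s : ℕ → Vec n) (k : ℕ) : Monotone fun N => window s N k := fun _ _ h =>
  Finset.sum_le_sum_of_subset_of_nonneg (Finset.Icc_subset_Icc_right h)
    fun _ _ _ => stepLength_nonneg s _

theorem window_zero_right (s : ℕ → Vec n) (N : ℕ) : window s N 0 = N := by
  rw [window, Finset.sum_congr rfl fun i hi =>
    stepLength_of_neg s (by have := (Finset.mem_Icc.mp hi).1; omega)]
  simp

theorem window_succ_succ (s : ℕ → Vec n) (N k : ℕ) :
    window s (N + 1) (k + 1) = ‖s k‖ + window s N k := by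
  induction N with
  | zero => simp [window, stepLength_natCast]
  | succ N ih =>
    rw [window, Finset.sum_Icc_succ_top (Nat.le_add_left 1 _), ← window, ih, add_assoc,
      window, window, Finset.sum_Icc_succ_top (Nat.le_add_left 1 _)]
    congr 3
    push_cast
    ring

theorem window_succ_le (s : ℕ → Vec n) (N k : ℕ) :
    window s N (k + 1) ≤ ‖s k‖ + window s N k :=
  (window_mono s (k + 1) N.le_succ).trans_eq (window_succ_succ s N k)

theorem sum_window_succ_pow_le (s : ℕ → Vec n) (N q k : ℕ) :
    ∑ j ∈ Finset.range k, window s N (j + 1) ^ (q + 1) ≤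
      (N : ℝ) ^ (q + 2) * (1 + ∑ j ∈ Finset.range k, ‖s j‖ ^ (q + 1)) := by
  set S := ∑ j ∈ Finset.range k, ‖s j‖ ^ (q + 1)
  have hS : 0 ≤ S := Finset.sum_nonneg fun _ _ => by positivity
  have hpow (j : ℕ) : window s N (j + 1) ^ (q + 1) ≤
      (N : ℝ) ^ q * ∑ i ∈ Finset.Icc 1 N, stepLength s (((j + 1 : ℕ) : ℤ) - (i : ℤ)) ^ (q + 1) := by
    simpa [window] using pow_sum_le_card_mul_sum_pow (s := Finset.Icc 1 N)
      (fun i _ => stepLength_nonneg s (((j + 1 : ℕ) : ℤ) - (i : ℤ))) q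
  have hshift : ∀ i ∈ Finset.Icc 1 N,
      ∑ j ∈ Finset.range k, stepLength s (((j + 1 : ℕ) : ℤ) - (i : ℤ)) ^ (q + 1) ≤ N * (1 + S) := by
    intro i hi
    obtain ⟨hi1, hiN⟩ := Finset.mem_Icc.mp hi
    obtain ⟨i, rfl⟩ := Nat.exists_eq_add_of_le' hi1
    have hsum := sum_stepLength_sub_pow_le s (q + 1) k i
    have hiN' : (i : ℝ) + 1 ≤ N := by exact_mod_cast hiN
    simp only [Nat.cast_succ, add_sub_add_right_eq_sub]
    nlinarith [mul_nonneg (Nat.cast_nonneg (α := ℝ) i) hS]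
  calc _ ≤ ∑ j ∈ Finset.range k, (N : ℝ) ^ q *
        ∑ i ∈ Finset.Icc 1 N, stepLength s (((j + 1 : ℕ) : ℤ) - (i : ℤ)) ^ (q + 1) :=
        Finset.sum_le_sum fun j _ => hpow j
    _ ≤ (N : ℝ) ^ q * ∑ _i ∈ Finset.Icc 1 N, N * (1 + S) := by
        rw [← Finset.mul_sum, Finset.sum_comm]
        gcongr with i hi
        exact hshift i hi
    _ = (N : ℝ) ^ (q + 2) * (1 + S) := by
        simp only [Finset.sum_const, Nat.card_Icc, Nat.add_sub_cancel, nsmul_eq_mul]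
        ring

end Window

theorem succ_mod_eq_succ_of_ne_zero {k m : ℕ} (h : (k + 1) % m ≠ 0) : (k + 1) % m = k % m + 1 := by
  have hdiv : (k + 1) / m = k / m :=
    Nat.succ_div_of_not_dvd fun hdvd => h (Nat.mod_eq_zero_of_dvd hdvd)
  have hsucc := Nat.div_add_mod (k + 1) m
  rw [hdiv] at hsucc
  linarith [Nat.div_add_mod k m]

namespace TensorCondition

variable {n p m : ℕ} {κA κB κC L : ℝ} {f : Vec n → ℝ} {x s : ℕ → Vec n} {T : ℕ → Tensor n p}

theorem norm_sub_succ_le (h : TensorCondition p m κA κB κC f x s T) (hκC : 0 ≤ κC) (hL : 0 ≤ L)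
    (hf : ContDiff ℝ p f)
    (hlip : ∀ x y, ‖iteratedFDeriv ℝ p f x - iteratedFDeriv ℝ p f y‖ ≤ L * ‖x - y‖)
    {k : ℕ} (hx : x (k + 1) = x k + s k) (hk : (k + 1) % m ≠ 0) :
    ‖T (k + 1) - iteratedFDeriv ℝ p f (x (k + 1))‖ ≤
      (1 + κC) * (‖T k - iteratedFDeriv ℝ p f (x k)‖ + L * ‖s k‖) := by
  have hleft : ‖averagedTensor p f (x k) (s k) - iteratedFDeriv ℝ p f (x k)‖ ≤ L * ‖s k‖ := by
    simpa using norm_averagedTensor_sub_le hf hL hlip (x k) (s k) (a := 0) (by simp)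
  have hright : ‖averagedTensor p f (x k) (s k) - iteratedFDeriv ℝ p f (x (k + 1))‖ ≤
      L * ‖s k‖ := by
    simpa [hx] using norm_averagedTensor_sub_le hf hL hlip (x k) (s k) (a := 1) (by simp)
  have hold : ‖T k - averagedTensor p f (x k) (s k)‖ ≤
      ‖T k - iteratedFDeriv ℝ p f (x k)‖ + L * ‖s k‖ := by
    rw [norm_sub_rev] at hleft
    exact (norm_sub_le_norm_sub_add_norm_sub _ _ _).trans (by gcongr)
  calc _ ≤ ‖T (k + 1) - averagedTensor p f (x k) (s k)‖ +
        ‖averagedTensor p f (x k) (s k) - iteratedFDeriv ℝ p f (x (k + 1))‖ :=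
        norm_sub_le_norm_sub_add_norm_sub _ _ _
    _ ≤ κC * (‖T k - iteratedFDeriv ℝ p f (x k)‖ + L * ‖s k‖) + L * ‖s k‖ := by
        gcongr
        exact (h.update k hk).trans (by gcongr)
    _ ≤ _ := by linarith [norm_nonneg (T k - iteratedFDeriv ℝ p f (x k))]

theorem norm_sub_le_mod (h : TensorCondition p m κA κB κC f x s T) (hκA : 0 ≤ κA)
    (hκC : 0 ≤ κC) (hL : 0 ≤ L) (hf : ContDiff ℝ p f)
    (hlip : ∀ x y, ‖iteratedFDeriv ℝ p f x - iteratedFDeriv ℝ p f y‖ ≤ L * ‖x - y‖)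
    (hx : ∀ k, x (k + 1) = x k + s k) (k : ℕ) :
    ‖T k - iteratedFDeriv ℝ p f (x k)‖ ≤
      (1 + κC) ^ (k % m) * (κA + ((k % m : ℕ) : ℝ) * L) * window s (m + k % m) k := by
  have hrestart (k : ℕ) (hk : k % m = 0) : ‖T k - iteratedFDeriv ℝ p f (x k)‖ ≤
      (1 + κC) ^ (k % m) * (κA + ((k % m : ℕ) : ℝ) * L) * window s (m + k % m) k := by
    simpa [hk, window] using (h.restart k hk).trans (min_le_left _ _)
  induction k with
  | zero => exact hrestart 0 (Nat.zero_mod m)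
  | succ k ih =>
    by_cases hk : (k + 1) % m = 0
    · exact hrestart _ hk
    rw [succ_mod_eq_succ_of_ne_zero hk, ← add_assoc, window_succ_succ, Nat.cast_succ, pow_succ']
    set j := k % m
    set c := (1 + κC) ^ j
    have hc : 1 ≤ c := one_le_pow₀ (by linarith)
    have hw := window_nonneg s (m + j) k
    calc _ ≤ (1 + κC) * (‖T k - iteratedFDeriv ℝ p f (x k)‖ + L * ‖s k‖) :=
          h.norm_sub_succ_le hκC hL hf hlip (hx k) hk
      _ ≤ (1 + κC) * (c * (κA + j * L) * window s (m + j) k + c * (L * ‖s k‖)) := by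
          exact mul_le_mul_of_nonneg_left
            (add_le_add ih (le_mul_of_one_le_left (by positivity) hc)) (by positivity)
      _ = (1 + κC) * c * ((κA + j * L) * window s (m + j) k + L * ‖s k‖) := by ring
      _ ≤ (1 + κC) * c * ((κA + (j + 1) * L) * (‖s k‖ + window s (m + j) k)) := by
          gcongr
          linarith [mul_nonneg hL hw, mul_nonneg hκA (norm_nonneg (s k)),
            mul_nonneg (mul_nonneg j.cast_nonneg hL) (norm_nonneg (s k))]
      _ = _ := by ring

theorem norm_sub_le (h : TensorCondition p m κA κB κC f x s T) (hm : 1 ≤ m) (hκA : 0 ≤ κA)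
    (hκC : 0 ≤ κC) (hL : 0 ≤ L) (hf : ContDiff ℝ p f)
    (hlip : ∀ x y, ‖iteratedFDeriv ℝ p f x - iteratedFDeriv ℝ p f y‖ ≤ L * ‖x - y‖)
    (hx : ∀ k, x (k + 1) = x k + s k) (k : ℕ) :
    ‖T k - iteratedFDeriv ℝ p f (x k)‖ ≤
      (1 + κC) ^ m * (κA + m * L) * window s (2 * m) k := by
  have hmod : k % m ≤ m := (Nat.mod_lt k hm).le
  have hwindow : window s (m + k % m) k ≤ window s (2 * m) k := window_mono s k (by omega)
  have hnonneg := window_nonneg s (m + k % m) k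
  refine (h.norm_sub_le_mod hκA hκC hL hf hlip hx k).trans ?_
  gcongr
  linarith

end TensorCondition

section Step

variable {n p : ℕ}

theorem approxTaylor_zero (hp : 0 < p) (f : Vec n → ℝ) (x : Vec n) (T : Tensor n p) :
    approxTaylor p f x T 0 = f x := by
  have hT : T (fun _ => 0) = 0 := T.map_coord_zero ⟨0, hp⟩ rfl
  rw [approxTaylor, Finset.sum_eq_zero fun i hi => ?_, hT]
  · ring
  · rw [(iteratedFDeriv ℝ i f x).map_coord_zero ⟨0, (Finset.mem_Icc.mp hi).1⟩ rfl, mul_zero]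

theorem approxTaylor_add_le_of_model_le (hp : 0 < p) {f : Vec n → ℝ} {x s : Vec n}
    {T : Tensor n p} {σ : ℝ} (hmodel : model p f x T σ s - model p f x T σ 0 ≤ 0) :
    approxTaylor p f x T s + σ * ‖s‖ ^ (p + 1) / ((p + 1).factorial : ℝ) ≤ f x := by
  simp only [model, approxTaylor_zero hp, norm_zero, zero_pow p.succ_ne_zero, mul_zero,
    add_zero] at hmodel
  rw [mul_div_right_comm]
  linarith

theorem map_add_le_of_model_le (hp : 0 < p) {f : Vec n → ℝ} {x s : Vec n} {T : Tensor n p}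
    {σ R : ℝ} (hmodel : model p f x T σ s - model p f x T σ 0 ≤ 0)
    (hR : ‖iteratedFDeriv ℝ 0 f (x + s) - iteratedFDeriv ℝ 0 (approxTaylor p f x T) s‖ ≤ R) :
    f (x + s) ≤ f x - σ * ‖s‖ ^ (p + 1) / ((p + 1).factorial : ℝ) + R := by
  have happly := (iteratedFDeriv ℝ 0 f (x + s) -
    iteratedFDeriv ℝ 0 (approxTaylor p f x T) s).le_opNorm ![]
  simp only [sub_apply, iteratedFDeriv_zero_apply, Finset.univ_eq_empty, Finset.prod_empty,
    mul_one] at happly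
  linarith [approxTaylor_add_le_of_model_le hp hmodel, (le_abs_self _).trans happly]

theorem regularization_add_remainder_le {θ σ K c r W : ℝ} {i : ℕ} (hσ : 0 ≤ σ) (hK : 0 ≤ K)
    (hθK : θ ≤ K) (hcK : c ≤ K) (hr : 0 ≤ r) (hrW : r ≤ W) :
    θ * σ * r ^ i / (i.factorial : ℝ) + c * W ^ i ≤ K * (1 + σ) * W ^ i := by
  have hW : 0 ≤ W := hr.trans hrW
  have hfac : (1 : ℝ) ≤ i.factorial := by exact_mod_cast i.factorial_pos
  calc _ ≤ K * σ * r ^ i / (i.factorial : ℝ) + K * W ^ i := by gcongr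
    _ ≤ K * σ * W ^ i + K * W ^ i := by
        gcongr
        exact (div_le_self (by positivity) hfac).trans (by gcongr)
    _ = K * (1 + σ) * W ^ i := by ring

theorem neg_mul_norm_pow_le_of_unitBall {E : Type*} [NormedAddCommGroup E] [NormedSpace ℝ E]
    {i : ℕ} {A : E [×i]→L[ℝ] ℝ} {κ : ℝ} (hA : ∀ d : E, ‖d‖ ≤ 1 → -κ ≤ A fun _ => d) (s : E) :
    -(κ * ‖s‖ ^ i) ≤ A fun _ => s := by
  have hunit : ‖‖s‖⁻¹ • s‖ ≤ 1 := by
    rw [norm_smul, norm_inv, norm_norm]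
    exact inv_mul_le_one
  have hhom : A (fun _ => s) = ‖s‖ ^ i * A fun _ => ‖s‖⁻¹ • s := by
    have hs : ‖s‖ • ‖s‖⁻¹ • s = s := by
      rcases eq_or_ne s 0 with rfl | hs
      · simp
      · exact smul_inv_smul₀ (norm_ne_zero_iff.mpr hs) s
    simpa [hs] using A.map_smul_univ (fun _ => ‖s‖) fun _ => ‖s‖⁻¹ • s
  rw [hhom, mul_comm κ, ← mul_neg]
  exact mul_le_mul_of_nonneg_left (hA _ hunit) (by positivity)

theorem ObjectiveAssumptions.neg_mul_norm_pow_le {L κhigh κp flow : ℝ} {f : Vec n → ℝ}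
    (hf : ObjectiveAssumptions p L κhigh κp flow f) (hp : 2 ≤ p) (hκhigh : 0 ≤ κhigh)
    (x s : Vec n) {i : ℕ} (hi1 : 1 ≤ i) (hip : i ≤ p) :
    -((‖∇ f x‖ + negCurv f x + κhigh + |κp|) * ‖s‖ ^ i) ≤ iteratedFDeriv ℝ i f x fun _ => s := by
  have hgrad := norm_nonneg (∇ f x)
  have hcurv := negCurv_nonneg f x
  have hκp := abs_nonneg κp
  have weaken {a : ℝ} (h : -(a * ‖s‖ ^ i) ≤ iteratedFDeriv ℝ i f x fun _ => s)
      (ha : a ≤ ‖∇ f x‖ + negCurv f x + κhigh + |κp|) :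
      -((‖∇ f x‖ + negCurv f x + κhigh + |κp|) * ‖s‖ ^ i) ≤ iteratedFDeriv ℝ i f x fun _ => s :=
    le_trans (by gcongr) h
  obtain rfl | rfl | hi3 : i = 1 ∨ i = 2 ∨ 3 ≤ i := by omega
  · exact weaken (a := ‖∇ f x‖) (by simpa using neg_norm_gradient_mul_le f x s) (by linarith)
  · exact weaken (neg_negCurv_mul_le (hf.contDiff.of_le (by exact_mod_cast hp)) x s) (by linarith)
  obtain rfl | hip := hip.eq_or_lt
  · have hnorm : -(‖iteratedFDeriv ℝ i f x‖ * ‖s‖ ^ i) ≤ iteratedFDeriv ℝ i f x fun _ => s := by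
      simpa using neg_le_of_abs_le ((iteratedFDeriv ℝ i f x).le_opNorm fun _ => s)
    exact weaken hnorm ((hf.bounded hi3 x).trans (by linarith [le_abs_self κp]))
  · exact weaken (neg_mul_norm_pow_le_of_unitBall
      (hf.intermediate i (Finset.mem_Icc.mpr ⟨hi3, by omega⟩) x) s) (by linarith)

theorem neg_le_one_div_factorial_mul {a b : ℝ} (hb : 0 ≤ b) (h : -b ≤ a) (i : ℕ) :
    -b ≤ 1 / (i.factorial : ℝ) * a := by
  have hfac : 1 / (i.factorial : ℝ) ≤ 1 :=
    div_le_one_of_le₀ (by exact_mod_cast i.factorial_pos) (Nat.cast_nonneg _)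
  calc -b ≤ 1 / (i.factorial : ℝ) * -b := by
        rw [mul_neg]
        exact neg_le_neg (mul_le_of_le_one_left hb hfac)
    _ ≤ 1 / (i.factorial : ℝ) * a := by gcongr

theorem sub_le_approxTaylor (hp : 0 < p) {f : Vec n → ℝ} {x s : Vec n} {B : ℝ} (hB : 0 ≤ B)
    (hlow : ∀ i ∈ Finset.Icc 1 p, -(B * ‖s‖ ^ i) ≤ iteratedFDeriv ℝ i f x fun _ => s)
    (hs : 1 ≤ ‖s‖) (T : Tensor n p) :
    f x - p * ((B + ‖T - iteratedFDeriv ℝ p f x‖) * ‖s‖ ^ p) ≤ approxTaylor p f x T s := by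
  set e := ‖T - iteratedFDeriv ℝ p f x‖
  have he : 0 ≤ e := norm_nonneg _
  have hterm : ∀ i ∈ Finset.Icc 1 (p - 1), -((B + e) * ‖s‖ ^ p) ≤
      1 / (i.factorial : ℝ) * iteratedFDeriv ℝ i f x fun _ => s := by
    intro i hi
    obtain ⟨hi1, hip⟩ := Finset.mem_Icc.mp hi
    refine neg_le_one_div_factorial_mul (by positivity) (le_trans (neg_le_neg ?_)
      (hlow i (Finset.mem_Icc.mpr ⟨hi1, by omega⟩))) i
    gcongr
    · linarith
    · omega
  have htop : -((B + e) * ‖s‖ ^ p) ≤ 1 / (p.factorial : ℝ) * T fun _ => s := by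
    refine neg_le_one_div_factorial_mul (by positivity) ?_ p
    have hdiff := (T - iteratedFDeriv ℝ p f x).le_opNorm fun _ => s
    simp only [sub_apply, Finset.prod_const, Finset.card_univ, Fintype.card_fin] at hdiff
    linarith [neg_le_of_abs_le hdiff, hlow p (Finset.mem_Icc.mpr ⟨hp, le_rfl⟩)]
  have hsum := Finset.card_nsmul_le_sum _ _ _ hterm
  rw [Nat.card_Icc, nsmul_eq_mul, Nat.add_sub_cancel, Nat.cast_pred hp] at hsum
  rw [approxTaylor]
  linarith

theorem sigma_mul_norm_le_of_model_le (hp : 2 ≤ p) {L κhigh κp flow σ : ℝ} {f : Vec n → ℝ}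
    (hf : ObjectiveAssumptions p L κhigh κp flow f) (hκhigh : 0 ≤ κhigh) {x s : Vec n}
    {T : Tensor n p} (hmodel : model p f x T σ s - model p f x T σ 0 ≤ 0) (hs : 1 ≤ ‖s‖) :
    σ * ‖s‖ ≤ (p + 1).factorial * (p * (‖∇ f x‖ + negCurv f x + κhigh + |κp| +
      ‖T - iteratedFDeriv ℝ p f x‖)) := by
  have hB : 0 ≤ ‖∇ f x‖ + negCurv f x + κhigh + |κp| := by
    linarith [norm_nonneg (∇ f x), negCurv_nonneg f x, abs_nonneg κp]
  have hlow := sub_le_approxTaylor (by omega) hB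
    (fun i hi => hf.neg_mul_norm_pow_le hp hκhigh x s (Finset.mem_Icc.mp hi).1
      (Finset.mem_Icc.mp hi).2) hs T
  have hreg : σ * ‖s‖ ^ (p + 1) / ((p + 1).factorial : ℝ) ≤
      p * ((‖∇ f x‖ + negCurv f x + κhigh + |κp| + ‖T - iteratedFDeriv ℝ p f x‖) * ‖s‖ ^ p) := by
    linarith [approxTaylor_add_le_of_model_le (by omega) hmodel]
  rw [div_le_iff₀' (by positivity), pow_succ'] at hreg
  refine le_of_mul_le_mul_right ?_ (by positivity : 0 < ‖s‖ ^ p)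
  linarith

end Step

namespace IsRun

variable {n p m : ℕ} {σ₀ θ₁ θ₂ κA κB κC L κhigh κp flow E K : ℝ} {f : Vec n → ℝ}
  {x s : ℕ → Vec n} {σ : ℕ → ℝ} {T : ℕ → Tensor n p}

theorem sigma_pos (h : IsRun p m σ₀ θ₁ θ₂ κA κB κC f x s σ T) (hσ₀ : 0 < σ₀) (k : ℕ) : 0 < σ k :=
  pos_of_succ_eq h.sigma_succ (hσ₀.trans_eq h.sigma_zero.symm) (fun _ => by positivity) k

theorem norm_gradient_succ_le (h : IsRun p m σ₀ θ₁ θ₂ κA κB κC f x s σ T) (hσ₀ : 0 < σ₀)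
    (hK : 0 ≤ K) (hθ₁K : θ₁ ≤ K) {c W : ℝ} (hcK : c ≤ K) {k : ℕ} (hW : ‖s k‖ ≤ W)
    (htaylor : ‖iteratedFDeriv ℝ 1 f (x k + s k) -
      iteratedFDeriv ℝ 1 (approxTaylor p f (x k) (T k)) (s k)‖ ≤ c * W ^ p) :
    ‖∇ f (x (k + 1))‖ ≤ K * (1 + σ k) * W ^ p := by
  rw [h.iterate]
  calc ‖∇ f (x k + s k)‖
      ≤ ‖∇ (approxTaylor p f (x k) (T k)) (s k)‖ +
          ‖∇ f (x k + s k) - ∇ (approxTaylor p f (x k) (T k)) (s k)‖ :=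
        norm_le_norm_add_norm_sub' _ _
    _ ≤ θ₁ * σ k * ‖s k‖ ^ p / (p.factorial : ℝ) + c * W ^ p :=
        add_le_add (h.first_order k) ((norm_gradient_sub_le _ _ _ _).trans htaylor)
    _ ≤ K * (1 + σ k) * W ^ p :=
        regularization_add_remainder_le (h.sigma_pos hσ₀ k).le hK hθ₁K hcK (norm_nonneg _) hW

theorem negCurv_succ_le (h : IsRun p m σ₀ θ₁ θ₂ κA κB κC f x s σ T) (hσ₀ : 0 < σ₀)
    (hp : 0 < p) (hf : ContDiff ℝ 2 f) (hK : 0 ≤ K) (hθ₂K : θ₂ ≤ K) {c W : ℝ} (hcK : c ≤ K)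
    {k : ℕ} (hW : ‖s k‖ ≤ W)
    (htaylor : ‖iteratedFDeriv ℝ 2 f (x k + s k) -
      iteratedFDeriv ℝ 2 (approxTaylor p f (x k) (T k)) (s k)‖ ≤ c * W ^ (p - 1)) :
    negCurv f (x (k + 1)) ≤ K * (1 + σ k) * W ^ (p - 1) := by
  rw [h.iterate]
  calc negCurv f (x k + s k)
      ≤ negCurv (approxTaylor p f (x k) (T k)) (s k) + ‖iteratedFDeriv ℝ 2 f (x k + s k) -
          iteratedFDeriv ℝ 2 (approxTaylor p f (x k) (T k)) (s k)‖ :=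
        negCurv_le_add_norm_sub hf (contDiff_approxTaylor hp f (x k) (T k)) _ _
    _ ≤ θ₂ * σ k * ‖s k‖ ^ (p - 1) / ((p - 1).factorial : ℝ) + c * W ^ (p - 1) :=
        add_le_add (h.second_order k) htaylor
    _ ≤ K * (1 + σ k) * W ^ (p - 1) :=
        regularization_add_remainder_le (h.sigma_pos hσ₀ k).le hK hθ₂K hcK (norm_nonneg _) hW

theorem sigma_mul_norm_step_le (h : IsRun p m σ₀ θ₁ θ₂ κA κB κC f x s σ T)
    (hf : ObjectiveAssumptions p L κhigh κp flow f) (hp : 2 ≤ p) (hκhigh : 0 ≤ κhigh)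
    (hE : 0 ≤ E) (hK : (p + 1).factorial * (p * (1 + κhigh + |κp| + E)) ≤ K) {k : ℕ} {V : ℝ}
    (hV : 0 ≤ V) (herr : ‖T k - iteratedFDeriv ℝ p f (x k)‖ ≤ E * V) (hs : 1 ≤ ‖s k‖) :
    σ k * ‖s k‖ ≤ K * (1 + ‖∇ f (x k)‖ + negCurv f (x k) + V) := by
  set g := ‖∇ f (x k)‖
  set b := negCurv f (x k)
  have hb : 0 ≤ b := negCurv_nonneg f (x k)
  have hsum : g + b + κhigh + |κp| + ‖T k - iteratedFDeriv ℝ p f (x k)‖ ≤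
      (1 + κhigh + |κp| + E) * (1 + g + b + V) := by
    have : 0 ≤ (κhigh + |κp| + E) * (g + b) + (1 + κhigh + |κp|) * V + (1 + E) := by positivity
    linarith
  calc σ k * ‖s k‖
      ≤ (p + 1).factorial * (p * (g + b + κhigh + |κp| + ‖T k - iteratedFDeriv ℝ p f (x k)‖)) :=
        sigma_mul_norm_le_of_model_le hp hf hκhigh (h.model_decrease k) hs
    _ ≤ (p + 1).factorial * (p * ((1 + κhigh + |κp| + E) * (1 + g + b + V))) := by gcongr
    _ = (p + 1).factorial * (p * (1 + κhigh + |κp| + E)) * (1 + g + b + V) := by ring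
    _ ≤ K * (1 + g + b + V) := by gcongr

/-- The scalar sequences along a run whose tensor errors are at most `E` times the window of the
last `N` step lengths. -/
def scalarRun (h : IsRun p m σ₀ θ₁ θ₂ κA κB κC f x s σ T)
    (hf : ObjectiveAssumptions p L κhigh κp flow f) (hp : 2 ≤ p) (hσ₀ : 0 < σ₀) (hL : 0 ≤ L)
    (hκhigh : 0 ≤ κhigh) (hE : 0 ≤ E) (hθ₁K : θ₁ ≤ K) (hθ₂K : θ₂ ≤ K) (hLEK : L + E ≤ K)
    (hK : (p + 1).factorial * (p * (1 + κhigh + |κp| + E)) ≤ K) {N : ℕ} {G : ℝ}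
    (herr : ∀ k, ‖T k - iteratedFDeriv ℝ p f (x k)‖ ≤ E * window s N k)
    (hgap : f (x 0) - flow ≤ G) (hgrad : ‖∇ f (x 0)‖ ≤ G) (hcurv : negCurv f (x 0) ≤ G)
    (hN : N ≤ G) : ScalarRun p K (((N + 1 : ℕ) : ℝ) ^ (p + 2)) G σ₀ :=
  have hK0 : 0 ≤ K := (add_nonneg hL hE).trans hLEK
  have hW (k : ℕ) : ‖s k‖ ≤ ‖s k‖ + window s N k := le_add_of_nonneg_right (window_nonneg s N k)
  have htaylor (k : ℕ) {i : ℕ} (hi : i ≤ p) : ‖iteratedFDeriv ℝ i f (x k + s k) -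
      iteratedFDeriv ℝ i (approxTaylor p f (x k) (T k)) (s k)‖ ≤
      (L + E) * (‖s k‖ + window s N k) ^ (p + 1 - i) :=
    norm_iteratedFDeriv_sub_approxTaylor_le_pow (by omega) hf.contDiff hL hf.lipschitz hE
      (window_nonneg s N k) (herr k) hi
  { gap := fun k => f (x k) - flow
    grad := fun k => ‖∇ f (x k)‖
    curv := fun k => negCurv f (x k)
    sigma := σ
    step := fun k => ‖s k‖
    window := window s N
    gap_nonneg := fun k => sub_nonneg.mpr (hf.lower_bound (x k))
    step_nonneg := fun k => norm_nonneg _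
    window_nonneg := window_nonneg s N
    gap_zero := hgap
    grad_zero := hgrad
    curv_zero := hcurv
    window_zero := (window_zero_right s N).trans_le hN
    sigma_zero := h.sigma_zero
    sigma_succ := h.sigma_succ
    window_succ := window_succ_le s N
    sum_window := fun k => by
      simpa only [window_succ_succ] using sum_window_succ_pow_le s (N + 1) p k
    gap_succ := fun k => by
      have hdecrease := map_add_le_of_model_le (by omega) (h.model_decrease k)
        ((htaylor k p.zero_le).trans
          (mul_le_mul_of_nonneg_right hLEK (pow_nonneg ((norm_nonneg _).trans (hW k)) _)))
      rw [Nat.sub_zero] at hdecrease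
      rw [h.iterate]
      linarith
    grad_succ := fun k => h.norm_gradient_succ_le hσ₀ hK0 hθ₁K hLEK (hW k)
      (htaylor k (by omega))
    curv_succ := fun k => h.negCurv_succ_le hσ₀ (by omega)
      (hf.contDiff.of_le (by exact_mod_cast hp)) hK0 hθ₂K hLEK (hW k) (htaylor k hp)
    step_le := fun k => h.sigma_mul_norm_step_le hf hp hκhigh hE hK (window_nonneg s N k)
      (herr k) }

end IsRun

end ARpApprox

end

theorem mainTheorem1_general (p m : ℕ) (hp : 2 ≤ p) (hm : 1 ≤ m)
    (σ₀ θ₁ θ₂ κA κB κC L κhigh κp Δ₀ G₀ B₀ : ℝ)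
    (hσ₀ : 0 < σ₀) (hκA : 0 ≤ κA) (hκC : 0 ≤ κC) (hL : 0 ≤ L) (hκhigh : 0 ≤ κhigh) :
    ∃ C : ℝ, 0 < C ∧
      ∀ (n : ℕ) (f : ARpApprox.Vec n → ℝ) (flow : ℝ)
        (x s : ℕ → ARpApprox.Vec n) (σ : ℕ → ℝ) (T : ℕ → ARpApprox.Tensor n p),
        ARpApprox.ObjectiveAssumptions p L κhigh κp flow f →
        ARpApprox.IsRun p m σ₀ θ₁ θ₂ κA κB κC f x s σ T →
        f (x 0) - flow ≤ Δ₀ → ‖∇ f (x 0)‖ ≤ G₀ → ARpApprox.negCurv f (x 0) ≤ B₀ →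
        (∀ k : ℕ, ∃ j ∈ Finset.Icc 1 (k + 1),
          ‖∇ f (x j)‖ ≤ C * ((k : ℝ) + 1) ^ (-((p : ℝ) / ((p : ℝ) + 1))) ∧
          ARpApprox.negCurv f (x j) ≤
            C * ((k : ℝ) + 1) ^ (-(((p : ℝ) - 1) / ((p : ℝ) + 1)))) ∧
        (∀ ε₁ ε₂ : ℝ, 0 < ε₁ → 0 < ε₂ →
          ∃ j : ℕ,
            (j : ℝ) ≤ C * max (ε₁ ^ (-(((p : ℝ) + 1) / (p : ℝ))))
                (ε₂ ^ (-(((p : ℝ) + 1) / ((p : ℝ) - 1)))) ∧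
            ARpApprox.IsSecondOrderStationary f ε₁ ε₂ (x j)) := by
  set E := (1 + κC) ^ m * (κA + m * L)
  set P := (p + 1).factorial * (p * (1 + κhigh + |κp| + E))
  set K := |θ₁| + |θ₂| + (L + E) + P
  set G := |Δ₀| + |G₀| + |B₀| + (2 * m : ℕ)
  have hE : 0 ≤ E := by positivity
  have hP : 0 ≤ P := by positivity
  have hcoeff : θ₁ ≤ K ∧ θ₂ ≤ K ∧ L + E ≤ K ∧ P ≤ K := by
    refine ⟨?_, ?_, ?_, ?_⟩ <;>
      linarith [le_abs_self θ₁, abs_nonneg θ₁, le_abs_self θ₂, abs_nonneg θ₂]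
  have hinit : Δ₀ ≤ G ∧ G₀ ≤ G ∧ B₀ ≤ G ∧ (2 * m : ℕ) ≤ G := by
    refine ⟨?_, ?_, ?_, ?_⟩ <;>
      linarith [le_abs_self Δ₀, abs_nonneg Δ₀, le_abs_self G₀, abs_nonneg G₀, le_abs_self B₀,
        abs_nonneg B₀, (2 * m : ℕ).cast_nonneg (α := ℝ)]
  obtain ⟨hθ₁K, hθ₂K, hLEK, hPK⟩ := hcoeff
  obtain ⟨hΔ₀, hG₀, hB₀, hmG⟩ := hinit
  obtain ⟨C, hC, hbound⟩ := ARpApprox.ScalarRun.exists_complexity_bound hp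
    (by positivity : 0 ≤ K) (by positivity : 0 ≤ ((2 * m + 1 : ℕ) : ℝ) ^ (p + 2))
    (by positivity : 0 ≤ G) hσ₀
  refine ⟨C, hC, fun n f flow x s σ T hf h hgap hgrad hcurv => ?_⟩
  have herr := h.tensor.norm_sub_le hm hκA hκC hL hf.contDiff hf.lipschitz h.iterate
  have hrun := hbound (h.scalarRun hf hp hσ₀ hL hκhigh hE hθ₁K hθ₂K hLEK hPK herr
    (hgap.trans hΔ₀) (hgrad.trans hG₀) (hcurv.trans hB₀) hmG)
  refine ⟨hrun.1, fun ε₁ ε₂ hε₁ hε₂ => ?_⟩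
  obtain ⟨j, hj, hgradj, hcurvj⟩ := hrun.2 ε₁ ε₂ hε₁ hε₂
  exact ⟨j, hj, hgradj, neg_le.mp ((le_max_right _ _).trans hcurvj)⟩

theorem mainTheorem1 (p m : ℕ) (hp : 2 ≤ p) (hm : 1 ≤ m)
    (σ₀ θ₁ θ₂ κA κB κC L κhigh κp Δ₀ G₀ B₀ : ℝ)
    (hσ₀ : 0 < σ₀) (hθ₁ : 1 < θ₁) (hθ₂ : 1 < θ₂) (hκA : 0 ≤ κA) (hκB : 0 ≤ κB) (hκC : 1 ≤ κC)
    (hL : 3 ≤ L) (hκhigh : 0 ≤ κhigh) :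
    ∃ C : ℝ, 0 < C ∧
      ∀ (n : ℕ) (f : ARpApprox.Vec n → ℝ) (flow : ℝ)
        (x s : ℕ → ARpApprox.Vec n) (σ : ℕ → ℝ) (T : ℕ → ARpApprox.Tensor n p),
        ARpApprox.ObjectiveAssumptions p L κhigh κp flow f →
        ARpApprox.IsRun p m σ₀ θ₁ θ₂ κA κB κC f x s σ T →
        f (x 0) - flow ≤ Δ₀ → ‖gradient f (x 0)‖ ≤ G₀ → ARpApprox.negCurv f (x 0) ≤ B₀ →
        (∀ k : ℕ,
          (Finset.Icc 1 (k + 1)).inf' (Finset.nonempty_Icc.mpr (Nat.le_add_left 1 k))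
              (fun j => ‖gradient f (x j)‖) ≤
            C * ((k : ℝ) + 1) ^ (-((p : ℝ) / ((p : ℝ) + 1)))) ∧
        (∀ k : ℕ,
          (Finset.Icc 1 (k + 1)).inf' (Finset.nonempty_Icc.mpr (Nat.le_add_left 1 k))
              (fun j => ARpApprox.negCurv f (x j)) ≤
            C * ((k : ℝ) + 1) ^ (-(((p : ℝ) - 1) / ((p : ℝ) + 1)))) ∧
        (∀ ε₁ ε₂ : ℝ, 0 < ε₁ → 0 < ε₂ →
          ∃ j : ℕ,
            (j : ℝ) ≤ C * max (ε₁ ^ (-(((p : ℝ) + 1) / (p : ℝ))))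
                (ε₂ ^ (-(((p : ℝ) + 1) / ((p : ℝ) - 1)))) ∧
            ARpApprox.IsSecondOrderStationary f ε₁ ε₂ (x j)) := by
  obtain ⟨C, hC, hrun⟩ := mainTheorem1_general p m hp hm σ₀ θ₁ θ₂ κA κB κC L κhigh κp Δ₀ G₀ B₀
    hσ₀ hκA (by linarith) (by linarith) hκhigh
  refine ⟨C, hC, fun n f flow x s σ T hf h hΔ₀ hG₀ hB₀ => ?_⟩
  obtain ⟨hrate, hstationary⟩ := hrun n f flow x s σ T hf h hΔ₀ hG₀ hB₀
  refine ⟨fun k => ?_, fun k => ?_, hstationary⟩ <;> obtain ⟨j, hj, hgrad, hcurv⟩ := hrate k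
  · exact Finset.inf'_le_of_le _ hj hgrad
  · exact Finset.inf'_le_of_le _ hj hcurv
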